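/- **Setting.** Let $\Sigma$ be a single-sorted relational signature of arbitrary size (relation symbols with finite arities, equality always included). *Regular formulas* are built from atomic formulas with $\top,\wedge,\exists$; *Horn formulas* are those without $\exists$. A *regular theory* $\mathbb T$ is a set of regular sequents $\phi\vdash_{\mathbf x}\psi$, and provability is derivability in the usual sequent calculus of regular logic (contexts may be empty, so $\top\vdash\exists x\,(x=x)$ is not derivable in general). $\mathcal C_{\mathbb T}$ is the (regular) syntactic category: objects are regular formulas-in-context $[\mathbf x\mid\phi]$, morphisms are $\mathbb T$-provable equivalence classes of $\mathbb T$-provably functional regular formulas. A *diagram* $(D,F)$ consists of a (possibly empty) set $D$ with an interpretation of the relation symbols and an equivalence relation that respects them and interprets $=$; $F$ is the set of its *facts*, i.e. pairs $(\phi,\mathbf d)$ with $\phi$ a Horn formula satisfied by $\mathbf d\in D$. It is a *model diagram* of $\mathbb T$ if it satisfies the axioms of $\mathbb T$. A *homomorphism* $(D_1,F_1)\to(D_2,F_2)$ is a left-total relation $h\subseteq D_1\times D_2$ that is closed under the equality of $(D_2,F_2)$ in its second argument and preserves facts. We write $(D,F)\subseteq(D',F')$ if $D\subseteq D'$ and $F\subseteq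 F'$; such an inclusion induces the homomorphism $\{(d,d') : (d=d')\in F'\}$. A *finitary extension* of $(D,F)$ is the least diagram with domain $D\cup\operatorname{Im}(\mathbf c)$ containing $F$ and one fact $\phi(\mathbf d,\mathbf c)$, where $\phi$ is Horn, $\mathbf d$ is a list in $D$ and $\mathbf c$ is a finite list of new elements (both lists may be empty). A *chase functor* on a set $\mathcal S$ of diagrams is a functor $\mathrm{Ch}:\mathcal S\to\mathcal S$ (with respect to homomorphisms) such that for all $(D,F)\in\mathcal S$: $(D,F)\subseteq\mathrm{Ch}(D,F)$, naturally in $(D,F)$; $\mathrm{Ch}(D,F)\models\mathbb T$; and if $\mathrm{Ch}(D,F)\models\psi(\mathbf d)$ with $\psi$ regular and $\mathbf d\in D$, then there is a regular $\phi$ with $(D,F)\models\phi(\mathbf d)$ and $\mathbb T$ proves $\phi\vdash_{\mathbf x}\psi$. The set $\mathcal S$ is *chase-complete* if (i) the empty diagram is in $\mathcal S$; (ii) for every $(D,F)\in\mathcal S$, each finitary extension of $(D,F)$ is isomorphic, as an extension of $(D,F)$, to a diagram $(D',F')\in\mathcal S$ with $(D,F)\subseteq(D',F')$ (the isomorphism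 commutes with the homomorphisms induced by the inclusions of $(D,F)$); (iii) there is a chase functor on $\mathcal S$; (iv) any finite list of diagrams in $\mathcal S$ has isomorphic copies in $\mathcal S$ with mutually disjoint domains. A set $\mathcal M$ of model diagrams of $\mathbb T$ is *chase-complete* if it is the set of all model diagrams of $\mathbb T$ in a chase-complete set $\mathcal S$ of diagrams. **Theorem.** Let $\mathbb T$ be a regular theory, $\mathcal M$ a chase-complete set of model diagrams of $\mathbb T$, and $\mathcal M^{\subseteq}$ the poset of the elements of $\mathcal M$ ordered by inclusion. Let $$\mathrm{Ev}:\mathcal C_{\mathbb T}\to\mathbf{Set}^{\mathcal M^{\subseteq}}$$ be the evaluation functor into the category of covariant functors $\mathcal M^{\subseteq}\to\mathbf{Set}$, which sends $[\mathbf x\mid\phi]$ to the functor assigning to $(D,F)\in\mathcal M$ the extension of $\phi$ in the quotient structure of $(D,F)$ by its equality. Then $\mathcal C_{\mathbb T}$ is a regular category and 1. $\mathrm{Ev}$ is conservative, i.e. it reflects isomorphisms; 2. $\mathrm{Ev}$ is conditionally sub-Heyting, i.e. it is regular (it preserves finite limits and regular epimorphisms) and it preserves any right adjoints to pullback functors that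 exist in $\mathcal C_{\mathbb T}$: whenever $f:A\to B$ in $\mathcal C_{\mathbb T}$ is such that $f^*:\mathrm{Sub}(B)\to\mathrm{Sub}(A)$ has a right adjoint $\forall_f$, the functor $\mathrm{Ev}(f)^*$ has a right adjoint $\forall_{\mathrm{Ev}(f)}$ and $\mathrm{Ev}(\forall_f(S))=\forall_{\mathrm{Ev}(f)}(\mathrm{Ev}(S))$ for all $S\in\mathrm{Sub}(A)$. -/

import Mathlib

open CategoryTheory CategoryTheory.Limits

universe u u' v w w' x x'

namespace RegLogic

/-- Regular formulas-in-context over a relational signature: `RegFormula L n` consists of the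
formulas built from atomic formulas by truth, conjunction and existential quantification, in a
context of `n` variables. Variables are de Bruijn levels, so formulas-in-context are automatically
identified up to renaming of bound variables and of the variables of the context. -/
inductive RegFormula (L : FirstOrder.Language.{u, u'}) : ℕ → Type u'
  | top {n : ℕ} : RegFormula L n
  | eq {n : ℕ} (i j : Fin n) : RegFormula L n
  | rel {n k : ℕ} (R : L.Relations k) (a : Fin k → Fin n) : RegFormula L n
  | and {n : ℕ} (φ ψ : RegFormula L n) : RegFormula L n
  | ex {n : ℕ} (φ : RegFormula L (n + 1)) : RegFormula L n

namespace RegFormula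

variable {L : FirstOrder.Language.{u, u'}}

/-- Horn formulas: conjunctions of atomic formulas. -/
def IsHorn : {n : ℕ} → RegFormula L n → Prop
  | _, top => True
  | _, eq _ _ => True
  | _, rel _ _ => True
  | _, and φ ψ => φ.IsHorn ∧ ψ.IsHorn
  | _, ex _ => False

/-- Extend a renaming of variables to one that fixes a new last variable. -/
def lift {n m : ℕ} (s : Fin n → Fin m) : Fin (n + 1) → Fin (m + 1) :=
  Fin.snoc (fun i => (s i).castSucc) (Fin.last m)

/-- Simultaneous (capture avoiding) substitution of variables for variables. -/
def subst : {n : ℕ} → RegFormula L n → {m : ℕ} → (Fin n → Fin m) → RegFormula L m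
  | _, top, _, _ => top
  | _, eq i j, _, s => eq (s i) (s j)
  | _, rel R a, _, s => rel R (fun i => s (a i))
  | _, and φ ψ, _, s => and (φ.subst s) (ψ.subst s)
  | _, ex φ, _, s => ex (φ.subst (lift s))

/-- Existential quantification over the last `m` variables of the context. -/
def exs {n : ℕ} : (m : ℕ) → RegFormula L (n + m) → RegFormula L n
  | 0, φ => φ
  | m + 1, φ => exs m (ex φ)

theorem lift_castSucc {n m : ℕ} (s : Fin n → Fin m) (i : Fin n) :
    lift s i.castSucc = (s i).castSucc := by
  simp [lift]

theorem lift_last {n m : ℕ} (s : Fin n → Fin m) : lift s (Fin.last n) = Fin.last m := by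
  simp [lift]

theorem lift_comp {n m k : ℕ} (s : Fin n → Fin m) (t : Fin m → Fin k) :
    (fun i => lift t (lift s i)) = lift (fun i => t (s i)) := by
  funext i
  refine Fin.lastCases ?_ (fun i => ?_) i
  · simp [lift_last]
  · simp [lift_castSucc]

theorem lift_id {n : ℕ} : lift (fun i : Fin n => i) = fun i => i := by
  funext i
  refine Fin.lastCases ?_ (fun i => ?_) i
  · simp [lift_last]
  · simp [lift_castSucc]

theorem subst_subst {n : ℕ} (φ : RegFormula L n) :
    ∀ {m k : ℕ} (s : Fin n → Fin m) (t : Fin m → Fin k),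
      (φ.subst s).subst t = φ.subst (fun i => t (s i)) := by
  induction φ with
  | top => intros; rfl
  | eq i j => intros; rfl
  | rel R a => intros; rfl
  | and φ ψ h1 h2 => intros; simp [subst, h1, h2]
  | ex φ h => intros; simp [subst, h, lift_comp]

theorem subst_id {n : ℕ} (φ : RegFormula L n) : φ.subst (fun i => i) = φ := by
  induction φ with
  | top => rfl
  | eq i j => rfl
  | rel R a => rfl
  | and φ ψ h1 h2 => simp [subst, h1, h2]
  | ex φ h => simp [subst, h, lift_id]

theorem comp_append {n m : ℕ} {A : Type w} {B : Type w'} (e : Fin n → A) (f : Fin m → A)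
    (g : A → B) :
    (fun i => g (Fin.append e f i)) = Fin.append (fun i => g (e i)) (fun i => g (f i)) := by
  funext i
  refine Fin.addCases (fun i => ?_) (fun i => ?_) i <;> simp

theorem append_cast {n m : ℕ} :
    Fin.append (fun i : Fin n => Fin.castAdd m i) (fun i : Fin m => Fin.natAdd n i) =
      fun i => i := by
  funext i
  refine Fin.addCases (fun i => ?_) (fun i => ?_) i <;> simp

theorem exs_subst {n : ℕ} : ∀ (m : ℕ) (φ : RegFormula L (n + m)) {k : ℕ} (s : Fin n → Fin k),
    (exs m φ).subst s =
      exs m (φ.subst (Fin.append (fun i => Fin.castAdd m (s i)) (fun i => Fin.natAdd k i)))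
  | 0, φ, k, s => by
    simp only [exs]
    congr 1
    funext i
    exact (Fin.append_left (fun i => Fin.castAdd 0 (s i)) (fun i => Fin.natAdd k i) i).symm
  | m + 1, φ, k, s => by
    simp only [exs]
    rw [exs_subst m]
    simp only [subst]
    congr 3
    funext i
    refine Fin.lastCases ?_ (fun i => ?_) i
    · rw [lift_last]
      exact (Fin.append_right (fun i => Fin.castAdd (m + 1) (s i)) (fun i => Fin.natAdd k i)
        (Fin.last m)).symm
    · rw [lift_castSucc]
      refine Fin.addCases (fun i => ?_) (fun i => ?_) i
      · rw [Fin.append_left]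
        exact (Fin.append_left (fun i => Fin.castAdd (m + 1) (s i)) (fun i => Fin.natAdd k i)
          i).symm
      · rw [Fin.append_right]
        exact (Fin.append_right (fun i => Fin.castAdd (m + 1) (s i)) (fun i => Fin.natAdd k i)
          i.castSucc).symm

end RegFormula

open RegFormula

/-- A regular sequent `hyp ⊢ concl` in a context of `arity` variables. -/
structure RegSequent (L : FirstOrder.Language.{u, u'}) where
  arity : ℕ
  hyp : RegFormula L arity
  concl : RegFormula L arity

/-- A regular theory: a set of regular sequents (the axioms). -/
abbrev RegTheory (L : FirstOrder.Language.{u, u'}) := Set (RegSequent L)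

/-- `Provable T φ ψ`: the sequent `φ ⊢ ψ` (in the common context of `φ` and `ψ`) is derivable from
the axioms in `T` in the sequent calculus of regular logic. Contexts are explicit and may be empty,
so that `⊤ ⊢ ∃ x, x = x` is not derivable in general. -/
inductive Provable {L : FirstOrder.Language.{u, u'}} (T : RegTheory L) :
    {n : ℕ} → RegFormula L n → RegFormula L n → Prop
  | ax (σ : RegSequent L) (hσ : σ ∈ T) : Provable T σ.hyp σ.concl
  | refl {n : ℕ} (φ : RegFormula L n) : Provable T φ φ
  | subst {n m : ℕ} {φ ψ : RegFormula L n} (s : Fin n → Fin m) (h : Provable T φ ψ) :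
      Provable T (φ.subst s) (ψ.subst s)
  | cut {n : ℕ} {φ ψ χ : RegFormula L n} (h₁ : Provable T φ ψ) (h₂ : Provable T ψ χ) :
      Provable T φ χ
  | eq_refl {n : ℕ} (i : Fin n) : Provable T top (eq i i)
  | eq_subst {n : ℕ} (i j : Fin n) (φ : RegFormula L n) :
      Provable T (and (eq i j) φ) (φ.subst (Function.update (fun k => k) i j))
  | top_intro {n : ℕ} (φ : RegFormula L n) : Provable T φ top
  | and_left {n : ℕ} (φ ψ : RegFormula L n) : Provable T (and φ ψ) φ
  | and_right {n : ℕ} (φ ψ : RegFormula L n) : Provable T (and φ ψ) ψ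
  | and_intro {n : ℕ} {φ ψ χ : RegFormula L n} (h₁ : Provable T φ ψ) (h₂ : Provable T φ χ) :
      Provable T φ (and ψ χ)
  | ex_elim {n : ℕ} {φ : RegFormula L (n + 1)} {ψ : RegFormula L n}
      (h : Provable T φ (ψ.subst Fin.castSucc)) : Provable T (ex φ) ψ
  | ex_intro {n : ℕ} {φ : RegFormula L (n + 1)} {ψ : RegFormula L n}
      (h : Provable T (ex φ) ψ) : Provable T φ (ψ.subst Fin.castSucc)
  | frobenius {n : ℕ} (φ : RegFormula L n) (ψ : RegFormula L (n + 1)) :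
      Provable T (and φ (ex ψ)) (ex (and (φ.subst Fin.castSucc) ψ))

namespace Provable

variable {L : FirstOrder.Language.{u, u'}} {T : RegTheory L}

theorem exs_adj {n : ℕ} : ∀ (m : ℕ) (φ : RegFormula L (n + m)) (ψ : RegFormula L n),
    Provable T (exs m φ) ψ ↔ Provable T φ (ψ.subst (Fin.castAdd m))
  | 0, φ, ψ => by
    have h : ψ.subst (Fin.castAdd 0) = ψ := subst_id ψ
    rw [h]
    rfl
  | m + 1, φ, ψ => by
    have h : ψ.subst (Fin.castAdd (m + 1)) = (ψ.subst (Fin.castAdd m)).subst Fin.castSucc := by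
      rw [subst_subst]; rfl
    rw [h]
    exact (exs_adj m (ex φ) ψ).trans ⟨ex_intro, ex_elim⟩

theorem exs_frobenius {n : ℕ} : ∀ (m : ℕ) (φ : RegFormula L n) (ψ : RegFormula L (n + m)),
    Provable T (and φ (exs m ψ)) (exs m (and (φ.subst (Fin.castAdd m)) ψ))
  | 0, φ, ψ => by
    have h : φ.subst (Fin.castAdd 0) = φ := subst_id φ
    rw [h]
    exact refl _
  | m + 1, φ, ψ => by
    have h : φ.subst (Fin.castAdd (m + 1)) = (φ.subst (Fin.castAdd m)).subst Fin.castSucc := by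
      rw [subst_subst]; rfl
    rw [h]
    refine (exs_frobenius m φ (ex ψ)).cut ?_
    rw [exs_adj]
    refine (frobenius _ _).cut ?_
    rw [← exs_adj]
    exact refl _

/-- Apply a derivation to variables of another context. -/
theorem mp {n k : ℕ} {φ ψ : RegFormula L n} {χ : RegFormula L k} (h : Provable T φ ψ)
    (e : Fin n → Fin k) (hχ : Provable T χ (φ.subst e)) : Provable T χ (ψ.subst e) :=
  hχ.cut (h.subst e)

theorem exs_intro {n m k : ℕ} {φ : RegFormula L (n + m)} {χ : RegFormula L k} (e : Fin n → Fin k)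
    (f : Fin m → Fin k) (h : Provable T χ (φ.subst (Fin.append e f))) :
    Provable T χ ((exs m φ).subst e) := by
  refine h.cut ?_
  have h1 : Provable T φ ((exs m φ).subst (Fin.castAdd m)) := (exs_adj m φ _).1 (refl _)
  have h2 := h1.subst (Fin.append e f)
  rw [subst_subst] at h2
  simpa using h2

theorem exs_elim {n m k : ℕ} {φ : RegFormula L (n + m)} {χ G : RegFormula L k} (e : Fin n → Fin k)
    (h : Provable T χ ((exs m φ).subst e))
    (hG : Provable T (and (χ.subst (Fin.castAdd m))
      (φ.subst (Fin.append (fun i => Fin.castAdd m (e i)) (fun i => Fin.natAdd k i))))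
      (G.subst (Fin.castAdd m))) : Provable T χ G := by
  rw [exs_subst] at h
  exact ((and_intro (refl χ) h).cut (exs_frobenius m _ _)).cut ((exs_adj _ _ _).2 hG)

theorem leibniz_one {n k : ℕ} (φ : RegFormula L n) {χ : RegFormula L k} (e : Fin n → Fin k)
    (p : Fin n) (j : Fin k) (h : Provable T χ (eq (e p) j)) (hφ : Provable T χ (φ.subst e)) :
    Provable T χ (φ.subst (Function.update e p j)) := by
  let φ' := φ.subst (Function.update (fun i => (e i).castSucc) p (Fin.last k))
  have h1 := (eq_subst (T := T) (Fin.last k) j.castSucc φ').subst (Fin.snoc (fun i => i) (e p))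
  have h2 : φ'.subst (Fin.snoc (fun i => i) (e p)) = φ.subst e := by
    simp only [φ', subst_subst]
    congr 1
    funext i
    by_cases hi : i = p
    · subst hi; simp
    · simp [hi, Function.update_of_ne]
  have h3 : (φ'.subst (Function.update (fun i => i) (Fin.last k) j.castSucc)).subst
      (Fin.snoc (fun i => i) (e p)) = φ.subst (Function.update e p j) := by
    simp only [φ', subst_subst]
    congr 1
    funext i
    by_cases hi : i = p
    · subst hi; simp
    · simp [hi, Function.update_of_ne, Fin.castSucc_ne_last]
  rw [h3] at h1
  refine (and_intro h hφ).cut ?_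
  simpa [RegFormula.subst, h2] using h1

/-- Equal variables may be substituted for each other. -/
theorem leibniz {n k : ℕ} (φ : RegFormula L n) {χ : RegFormula L k} (e f : Fin n → Fin k)
    (h : ∀ i, Provable T χ (eq (e i) (f i))) (hφ : Provable T χ (φ.subst e)) :
    Provable T χ (φ.subst f) := by
  classical
  have key : ∀ s : Finset (Fin n), Provable T χ (φ.subst (fun i => if i ∈ s then f i else e i)) := by
    intro s
    induction s using Finset.induction_on with
    | empty => simpa using hφ
    | insert p s hp ih =>
      have h1 := leibniz_one φ _ p (f p) (by simpa [hp] using h p) ih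
      refine Eq.mp ?_ h1
      congr 2
      funext i
      by_cases hi : i = p
      · subst hi; simp
      · simp [hi, Function.update_of_ne]
  simpa using key Finset.univ

theorem eq_symm {k : ℕ} {χ : RegFormula L k} {i j : Fin k} (h : Provable T χ (eq i j)) :
    Provable T χ (eq j i) :=
  leibniz (eq (0 : Fin 2) 1) ![i, i] ![j, i]
    (fun a => by fin_cases a; exacts [h, (top_intro _).cut (eq_refl _)])
    ((top_intro _).cut (eq_refl _))

theorem eq_trans {k : ℕ} {χ : RegFormula L k} {i j l : Fin k} (h : Provable T χ (eq i j))
    (h' : Provable T χ (eq j l)) : Provable T χ (eq i l) :=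
  leibniz (eq (0 : Fin 2) 1) ![i, j] ![i, l]
    (fun a => by fin_cases a; exacts [(top_intro _).cut (eq_refl _), h']) h

end Provable

namespace RegFormula

variable {L : FirstOrder.Language.{u, u'}}

/-- Finite conjunctions. -/
def conj {n : ℕ} : {m : ℕ} → (Fin m → RegFormula L n) → RegFormula L n
  | 0, _ => top
  | m + 1, ψ => and (conj fun i : Fin m => ψ i.castSucc) (ψ (Fin.last m))

theorem conj_subst {n k : ℕ} (s : Fin n → Fin k) :
    ∀ {m : ℕ} (ψ : Fin m → RegFormula L n), (conj ψ).subst s = conj fun i => (ψ i).subst s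
  | 0, _ => rfl
  | _ + 1, ψ => by simp only [conj, subst]; rw [conj_subst s]

/-- The relational composite `∃ y, θ(x, y) ∧ γ(y, z)` of formulas in contexts `x, y` and `y, z`. -/
def comp {n m k : ℕ} (θ : RegFormula L (n + m)) (γ : RegFormula L (m + k)) : RegFormula L (n + k) :=
  exs m (and
    (θ.subst (Fin.append (fun i => Fin.castAdd m (Fin.castAdd k i)) (fun j => Fin.natAdd (n + k) j)))
    (γ.subst (Fin.append (fun j => Fin.natAdd (n + k) j) (fun l => Fin.castAdd m (Fin.natAdd n l)))))

/-- The formula `φ(x) ∧ x = y` in context `x, y`. -/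
def eqGraph {n : ℕ} (φ : RegFormula L n) : RegFormula L (n + n) :=
  and (φ.subst (Fin.castAdd n)) (conj fun i : Fin n => eq (Fin.castAdd n i) (Fin.natAdd n i))

end RegFormula

namespace Provable

variable {L : FirstOrder.Language.{u, u'}} {T : RegTheory L}

theorem conj_intro {n : ℕ} {χ : RegFormula L n} :
    ∀ {m : ℕ} {ψ : Fin m → RegFormula L n}, (∀ i, Provable T χ (ψ i)) → Provable T χ (conj ψ)
  | 0, _, _ => top_intro _
  | _ + 1, _, h => and_intro (conj_intro fun i => h i.castSucc) (h _)

theorem conj_elim {n : ℕ} {χ : RegFormula L n} :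
    ∀ {m : ℕ} {ψ : Fin m → RegFormula L n}, Provable T χ (conj ψ) → ∀ i, Provable T χ (ψ i)
  | 0, _, _, i => i.elim0
  | m + 1, ψ, h, i => by
    refine Fin.lastCases ?_ (fun i => ?_) i
    · exact h.cut (and_right _ _)
    · exact conj_elim (m := m) (ψ := fun i => ψ i.castSucc) (h.cut (and_left _ _)) i

theorem mono {n k k' : ℕ} {φ : RegFormula L n} {χ : RegFormula L k} {χ' : RegFormula L k'}
    {e : Fin n → Fin k} {s : Fin k → Fin k'} (hs : Provable T χ' (χ.subst s))
    (h : Provable T χ (φ.subst e)) : Provable T χ' (φ.subst fun i => s (e i)) := by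
  rw [← subst_subst]
  exact hs.cut (h.subst s)

theorem mono₂ {n m k k' : ℕ} {φ : RegFormula L (n + m)} {χ : RegFormula L k} {χ' : RegFormula L k'}
    {e : Fin n → Fin k} {f : Fin m → Fin k} {s : Fin k → Fin k'} (hs : Provable T χ' (χ.subst s))
    (h : Provable T χ (φ.subst (Fin.append e f))) :
    Provable T χ' (φ.subst (Fin.append (fun i => s (e i)) (fun i => s (f i)))) := by
  rw [← comp_append]
  exact mono hs h

theorem exs_elim' {n m k : ℕ} {φ : RegFormula L (n + m)} {χ G : RegFormula L k} (e : Fin n → Fin k)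
    (h : Provable T χ ((exs m φ).subst e))
    (hG : ∀ {k' : ℕ} (χ' : RegFormula L k') (s : Fin k → Fin k') (f : Fin m → Fin k'),
      Provable T χ' (χ.subst s) → Provable T χ' (φ.subst (Fin.append (fun i => s (e i)) f)) →
      Provable T χ' (G.subst s)) : Provable T χ G :=
  exs_elim e h (hG _ _ _ (and_left _ _) (and_right _ _))

theorem of_forces {n m : ℕ} {φ ψ : RegFormula L (n + m)}
    (h : ∀ {k : ℕ} (χ : RegFormula L k) (e : Fin n → Fin k) (f : Fin m → Fin k),
      Provable T χ (φ.subst (Fin.append e f)) → Provable T χ (ψ.subst (Fin.append e f))) :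
    Provable T φ ψ := by
  have := h φ (fun i => Fin.castAdd m i) (fun i => Fin.natAdd n i)
  rw [append_cast, subst_id, subst_id] at this
  exact this (refl _)

theorem comp_intro {n m l k : ℕ} {θ : RegFormula L (n + m)} {γ : RegFormula L (m + l)}
    {χ : RegFormula L k} {e : Fin n → Fin k} (f : Fin m → Fin k) {g : Fin l → Fin k}
    (h₁ : Provable T χ (θ.subst (Fin.append e f))) (h₂ : Provable T χ (γ.subst (Fin.append f g))) :
    Provable T χ ((comp θ γ).subst (Fin.append e g)) := by
  refine exs_intro _ f ?_
  simp only [RegFormula.subst, subst_subst]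
  refine and_intro ?_ ?_
  · rw [comp_append]; simpa using h₁
  · rw [comp_append]; simpa using h₂

theorem comp_elim {n m l k : ℕ} {θ : RegFormula L (n + m)} {γ : RegFormula L (m + l)}
    {χ G : RegFormula L k} {e : Fin n → Fin k} {g : Fin l → Fin k}
    (h : Provable T χ ((comp θ γ).subst (Fin.append e g)))
    (hG : ∀ {k' : ℕ} (χ' : RegFormula L k') (s : Fin k → Fin k') (f : Fin m → Fin k'),
      Provable T χ' (χ.subst s) →
      Provable T χ' (θ.subst (Fin.append (fun i => s (e i)) f)) →
      Provable T χ' (γ.subst (Fin.append f (fun i => s (g i)))) →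
      Provable T χ' (G.subst s)) : Provable T χ G := by
  refine exs_elim' _ h fun χ' s f hs hf => ?_
  simp only [RegFormula.subst, subst_subst] at hf
  refine hG χ' s f hs ?_ ?_
  · have := hf.cut (and_left _ _)
    rw [comp_append] at this
    simpa using this
  · have := hf.cut (and_right _ _)
    rw [comp_append] at this
    simpa using this

theorem eqGraph_iff {n k : ℕ} {φ : RegFormula L n} {χ : RegFormula L k} {e f : Fin n → Fin k} :
    Provable T χ ((eqGraph φ).subst (Fin.append e f)) ↔
      Provable T χ (φ.subst e) ∧ ∀ i, Provable T χ (eq (e i) (f i)) := by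
  simp only [eqGraph, RegFormula.subst, subst_subst, conj_subst, Fin.append_left, Fin.append_right]
  exact ⟨fun h => ⟨h.cut (and_left _ _), conj_elim (h.cut (and_right _ _))⟩,
    fun h => and_intro h.1 (conj_intro h.2)⟩

end Provable

/-- Objects of the syntactic category of `T`: regular formulas-in-context. -/
structure SynCat {L : FirstOrder.Language.{u, u'}} (T : RegTheory L) where
  arity : ℕ
  formula : RegFormula L arity

namespace SynCat

variable {L : FirstOrder.Language.{u, u'}} {T : RegTheory L}

/-- A formula `θ` in context `x, y` is provably functional from `{x. φ}` to `{y. ψ}` if `T` proves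
`θ ⊢ φ ∧ ψ`, `φ ⊢ ∃ y, θ` and `θ(x, y) ∧ θ(x, z) ⊢ y = z`. -/
structure IsFunctional (A B : SynCat T) (θ : RegFormula L (A.arity + B.arity)) : Prop where
  dom_cod : Provable T θ
    (and (A.formula.subst (Fin.castAdd B.arity)) (B.formula.subst (Fin.natAdd A.arity)))
  total : Provable T A.formula (exs B.arity θ)
  unique : ∀ j : Fin B.arity, Provable T
    (and
      (θ.subst (Fin.append (fun i => Fin.castAdd B.arity (Fin.castAdd B.arity i))
        (fun j => Fin.castAdd B.arity (Fin.natAdd A.arity j))))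
      (θ.subst (Fin.append (fun i => Fin.castAdd B.arity (Fin.castAdd B.arity i))
        (fun j => Fin.natAdd (A.arity + B.arity) j))))
    (eq (Fin.castAdd B.arity (Fin.natAdd A.arity j)) (Fin.natAdd (A.arity + B.arity) j))

namespace IsFunctional

variable {A B : SynCat T} {θ : RegFormula L (A.arity + B.arity)}

theorem dom (h : IsFunctional A B θ) {k : ℕ} {χ : RegFormula L k} {e : Fin A.arity → Fin k}
    {f : Fin B.arity → Fin k} (hθ : Provable T χ (θ.subst (Fin.append e f))) :
    Provable T χ (A.formula.subst e) := by
  have := (h.dom_cod.cut (Provable.and_left _ _)).mp _ hθ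
  rw [subst_subst] at this
  simpa using this

theorem cod (h : IsFunctional A B θ) {k : ℕ} {χ : RegFormula L k} {e : Fin A.arity → Fin k}
    {f : Fin B.arity → Fin k} (hθ : Provable T χ (θ.subst (Fin.append e f))) :
    Provable T χ (B.formula.subst f) := by
  have := (h.dom_cod.cut (Provable.and_right _ _)).mp _ hθ
  rw [subst_subst] at this
  simpa using this

theorem total_elim (h : IsFunctional A B θ) {k : ℕ} {χ G : RegFormula L k} {e : Fin A.arity → Fin k}
    (hA : Provable T χ (A.formula.subst e))
    (hG : ∀ {k' : ℕ} (χ' : RegFormula L k') (s : Fin k → Fin k') (f : Fin B.arity → Fin k'),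
      Provable T χ' (χ.subst s) →
      Provable T χ' (θ.subst (Fin.append (fun i => s (e i)) f)) →
      Provable T χ' (G.subst s)) : Provable T χ G :=
  Provable.exs_elim' e (h.total.mp e hA) hG

theorem eq_of (h : IsFunctional A B θ) {k : ℕ} {χ : RegFormula L k} {e : Fin A.arity → Fin k}
    {f g : Fin B.arity → Fin k} (hf : Provable T χ (θ.subst (Fin.append e f)))
    (hg : Provable T χ (θ.subst (Fin.append e g))) (j : Fin B.arity) :
    Provable T χ (eq (f j) (g j)) := by
  have h1 := (h.unique j).mp (χ := χ) (Fin.append (Fin.append e f) g)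
  simp only [RegFormula.subst, subst_subst] at h1
  rw [comp_append, comp_append] at h1
  simp only [Fin.append_left, Fin.append_right] at h1
  exact h1 (Provable.and_intro hf hg)

theorem mk_of_forces
    (h₁ : ∀ {k : ℕ} (χ : RegFormula L k) (e : Fin A.arity → Fin k) (f : Fin B.arity → Fin k),
      Provable T χ (θ.subst (Fin.append e f)) →
        Provable T χ (A.formula.subst e) ∧ Provable T χ (B.formula.subst f))
    (h₂ : Provable T A.formula (exs B.arity θ))
    (h₃ : ∀ {k : ℕ} (χ : RegFormula L k) (e : Fin A.arity → Fin k) (f g : Fin B.arity → Fin k),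
      Provable T χ (θ.subst (Fin.append e f)) → Provable T χ (θ.subst (Fin.append e g)) →
        ∀ j, Provable T χ (eq (f j) (g j))) : IsFunctional A B θ where
  dom_cod := by
    have := h₁ θ (fun i => Fin.castAdd _ i) (fun i => Fin.natAdd _ i)
    rw [append_cast, subst_id] at this
    exact Provable.and_intro (this (Provable.refl _)).1 (this (Provable.refl _)).2
  total := h₂
  unique j := h₃ _ _ _ _ (Provable.and_left _ _) (Provable.and_right _ _) j

end IsFunctional

theorem isFunctional_graph (A : SynCat T) : IsFunctional A A (eqGraph A.formula) := by
  refine IsFunctional.mk_of_forces (fun χ e f h => ?_) ?_ (fun χ e f g hf hg j => ?_)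
  · rw [Provable.eqGraph_iff] at h
    exact ⟨h.1, Provable.leibniz _ _ _ h.2 h.1⟩
  · have := Provable.exs_intro (T := T) (φ := eqGraph A.formula) (χ := A.formula)
      (fun i => i) (fun i => i)
    rw [subst_id, Provable.eqGraph_iff, subst_id] at this
    exact this ⟨Provable.refl _, fun i => (Provable.top_intro _).cut (Provable.eq_refl _)⟩
  · rw [Provable.eqGraph_iff] at hf hg
    exact (hf.2 j).eq_symm.eq_trans (hg.2 j)

theorem isFunctional_comp {A B C : SynCat T} {θ : RegFormula L (A.arity + B.arity)}
    {γ : RegFormula L (B.arity + C.arity)} (hθ : IsFunctional A B θ) (hγ : IsFunctional B C γ) :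
    IsFunctional A C (comp θ γ) := by
  refine IsFunctional.mk_of_forces (fun χ e f h => ⟨?_, ?_⟩) ?_ (fun χ e f g hf hg j => ?_)
  · refine Provable.comp_elim h fun χ' s y hs h1 h2 => ?_
    rw [subst_subst]
    exact hθ.dom h1
  · refine Provable.comp_elim h fun χ' s y hs h1 h2 => ?_
    rw [subst_subst]
    exact hγ.cod h2
  · refine hθ.total_elim (e := fun i => i) (by rw [subst_id]; exact Provable.refl _)
      fun χ₁ s₁ y hs₁ h1 => ?_
    refine hγ.total_elim (hθ.cod h1) fun χ₂ s₂ z hs₂ h2 => ?_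
    rw [subst_subst]
    exact Provable.exs_intro _ z (Provable.comp_intro _ (Provable.mono₂ hs₂ h1) h2)
  · refine Provable.comp_elim hf fun χ₁ s₁ y hs₁ h1 h2 => ?_
    refine Provable.comp_elim (Provable.mono₂ hs₁ hg) fun χ₂ s₂ y' hs₂ h3 h4 => ?_
    have h5 := hθ.eq_of (Provable.mono₂ hs₂ h1) h3
    have h6 : Provable T χ₂ (γ.subst (Fin.append y' fun i => s₂ (s₁ (f i)))) := by
      refine Provable.leibniz γ _ _ (fun i => ?_) (Provable.mono₂ hs₂ h2)
      refine Fin.addCases (fun i => ?_) (fun i => ?_) i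
      · simpa using h5 i
      · simpa using (Provable.top_intro _).cut (Provable.eq_refl _)
    exact hγ.eq_of h6 h4 j

/-- `T`-provable equivalence of provably functional formulas. -/
instance homSetoid (A B : SynCat T) : Setoid {θ // IsFunctional A B θ} where
  r θ θ' := Provable T θ.1 θ'.1 ∧ Provable T θ'.1 θ.1
  iseqv := ⟨fun _ => ⟨Provable.refl _, Provable.refl _⟩, fun h => ⟨h.2, h.1⟩,
    fun h h' => ⟨h.1.cut h'.1, h'.2.cut h.2⟩⟩

/-- Morphisms of the syntactic category: `T`-provable equivalence classes of `T`-provably functional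
regular formulas. -/
def Hom (A B : SynCat T) : Type u' := Quotient (homSetoid A B)

theorem comp_mono {A B C : SynCat T} {θ θ' : RegFormula L (A.arity + B.arity)}
    {γ γ' : RegFormula L (B.arity + C.arity)} (h : Provable T θ θ') (h' : Provable T γ γ') :
    Provable T (comp θ γ) (comp θ' γ') := by
  refine Provable.of_forces fun χ e g hc => ?_
  refine Provable.comp_elim hc fun χ₁ s₁ y hs₁ h1 h2 => ?_
  rw [subst_subst, comp_append]
  exact Provable.comp_intro y (h.mp _ h1) (h'.mp _ h2)

/-- Composition in the syntactic category. -/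
def Hom.comp {A B C : SynCat T} : Hom A B → Hom B C → Hom A C :=
  Quotient.map₂ (fun θ γ => ⟨RegFormula.comp θ.1 γ.1, isFunctional_comp θ.2 γ.2⟩)
    fun _ _ h _ _ h' => ⟨comp_mono h.1 h'.1, comp_mono h.2 h'.2⟩

/-- The (regular) syntactic category of the regular theory `T`. -/
instance : Category.{u'} (SynCat T) where
  Hom := Hom
  id A := Quotient.mk _ ⟨eqGraph A.formula, isFunctional_graph A⟩
  comp := Hom.comp
  id_comp := by
    rintro A B ⟨θ, hθ⟩
    refine Quotient.sound ⟨Provable.of_forces fun χ e f h => ?_, Provable.of_forces fun χ e f h => ?_⟩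
    · refine Provable.comp_elim h fun χ₁ s₁ y hs₁ h1 h2 => ?_
      rw [Provable.eqGraph_iff] at h1
      rw [subst_subst, comp_append]
      refine Provable.leibniz θ _ _ (fun i => ?_) h2
      refine Fin.addCases (fun i => ?_) (fun i => ?_) i
      · simpa using (h1.2 i).eq_symm
      · simpa using (Provable.top_intro _).cut (Provable.eq_refl _)
    · refine Provable.comp_intro e ?_ h
      rw [Provable.eqGraph_iff]
      exact ⟨hθ.dom h, fun i => (Provable.top_intro _).cut (Provable.eq_refl _)⟩
  comp_id := by
    rintro A B ⟨θ, hθ⟩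
    refine Quotient.sound ⟨Provable.of_forces fun χ e f h => ?_, Provable.of_forces fun χ e f h => ?_⟩
    · refine Provable.comp_elim h fun χ₁ s₁ y hs₁ h1 h2 => ?_
      rw [Provable.eqGraph_iff] at h2
      rw [subst_subst, comp_append]
      refine Provable.leibniz θ _ _ (fun i => ?_) h1
      refine Fin.addCases (fun i => ?_) (fun i => ?_) i
      · simpa using (Provable.top_intro _).cut (Provable.eq_refl _)
      · simpa using h2.2 i
    · refine Provable.comp_intro f h ?_
      rw [Provable.eqGraph_iff]
      exact ⟨hθ.cod h, fun i => (Provable.top_intro _).cut (Provable.eq_refl _)⟩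
  assoc := by
    rintro A B C D ⟨θ, hθ⟩ ⟨γ, hγ⟩ ⟨δ, hδ⟩
    refine Quotient.sound ⟨Provable.of_forces fun χ e f h => ?_, Provable.of_forces fun χ e f h => ?_⟩
    · refine Provable.comp_elim h fun χ₁ s₁ z hs₁ h1 h2 => ?_
      refine Provable.comp_elim h1 fun χ₂ s₂ y hs₂ h3 h4 => ?_
      rw [subst_subst, subst_subst, comp_append (g := fun i => s₂ (s₁ i))]
      exact Provable.comp_intro y h3 (Provable.comp_intro _ h4 (Provable.mono₂ hs₂ h2))
    · refine Provable.comp_elim h fun χ₁ s₁ y hs₁ h1 h2 => ?_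
      refine Provable.comp_elim h2 fun χ₂ s₂ z hs₂ h3 h4 => ?_
      rw [subst_subst, subst_subst, comp_append (g := fun i => s₂ (s₁ i))]
      exact Provable.comp_intro z (Provable.comp_intro _ (Provable.mono₂ hs₂ h1) h3) h4

end SynCat

/-- A diagram on the set `A`: a structure together with an equivalence relation (interpreting
equality) that respects all the relations of the structure. The domain may be empty. -/
structure Diagram (L : FirstOrder.Language.{u, u'}) (A : Type w) where
  setoid : Setoid A
  rel : {k : ℕ} → L.Relations k → (Fin k → A) → Prop
  rel_congr : ∀ {k : ℕ} (R : L.Relations k) (a b : Fin k → A),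
    (∀ i, setoid (a i) (b i)) → rel R a → rel R b

namespace Diagram

variable {L : FirstOrder.Language.{u, u'}} {A : Type w} {B : Type w'} {C : Type x}

/-- Satisfaction of a regular formula by a tuple in a diagram, with equality interpreted as the
given equivalence relation. The *facts* of a diagram are the pairs `(φ, d)` with `φ` a Horn formula
and `X.Sat φ d`. -/
def Sat (X : Diagram L A) : {n : ℕ} → RegFormula L n → (Fin n → A) → Prop
  | _, .top, _ => True
  | _, .eq i j, d => X.setoid (d i) (d j)
  | _, .rel R a, d => X.rel R fun i => d (a i)
  | _, .and φ ψ, d => X.Sat φ d ∧ X.Sat ψ d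
  | _, .ex φ, d => ∃ a : A, X.Sat φ (Fin.snoc (α := fun _ => A) d a)

/-- `X` is a model diagram of `T`. -/
def IsModel (X : Diagram L A) (T : RegTheory L) : Prop :=
  ∀ σ ∈ T, ∀ d : Fin σ.arity → A, X.Sat σ.hyp d → X.Sat σ.concl d

/-- Inclusion of sets of facts, for diagrams with the same domain. -/
instance : LE (Diagram L A) where
  le X Y := ∀ (n : ℕ) (φ : RegFormula L n), φ.IsHorn → ∀ d : Fin n → A, X.Sat φ d → Y.Sat φ d

theorem comp_snoc {n : ℕ} {S : Type x} {S' : Type x'} (g : S → S') (d : Fin n → S) (a : S) :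
    (fun i => g (Fin.snoc (α := fun _ => S) d a i)) =
      Fin.snoc (α := fun _ => S') (fun i => g (d i)) (g a) := by
  funext i
  refine Fin.lastCases ?_ (fun i => ?_) i <;> simp

theorem sat_congr (X : Diagram L A) {n : ℕ} (φ : RegFormula L n) :
    ∀ {d e : Fin n → A}, (∀ i, X.setoid (d i) (e i)) → X.Sat φ d → X.Sat φ e := by
  induction φ with
  | top => intros; trivial
  | eq i j =>
    intro d e h hd
    exact X.setoid.trans (X.setoid.symm (h i)) (X.setoid.trans hd (h j))
  | rel R a =>
    intro d e h hd
    exact X.rel_congr R _ _ (fun i => h (a i)) hd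
  | and φ ψ h₁ h₂ =>
    intro d e h hd
    exact ⟨h₁ h hd.1, h₂ h hd.2⟩
  | ex φ ih =>
    rintro d e h ⟨a, ha⟩
    refine ⟨a, ih (fun i => ?_) ha⟩
    refine Fin.lastCases ?_ (fun i => ?_) i
    · simp
    · simpa using h i

theorem sat_subst (X : Diagram L A) {n : ℕ} (φ : RegFormula L n) :
    ∀ {m : ℕ} (s : Fin n → Fin m) (d : Fin m → A),
      X.Sat (φ.subst s) d ↔ X.Sat φ fun i => d (s i) := by
  induction φ with
  | top => intros; rfl
  | eq i j => intros; rfl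
  | rel R a => intros; rfl
  | and φ ψ h₁ h₂ => intro m s d; exact and_congr (h₁ s d) (h₂ s d)
  | ex φ ih =>
    intro m s d
    refine exists_congr fun a => ?_
    rw [ih]
    refine iff_of_eq (congrArg _ ?_)
    funext i
    refine Fin.lastCases ?_ (fun i => ?_) i
    · simp [lift_last]
    · simp [lift_castSucc]

theorem sat_exs (X : Diagram L A) {n : ℕ} :
    ∀ {m : ℕ} (φ : RegFormula L (n + m)) (d : Fin n → A),
      X.Sat (exs m φ) d ↔ ∃ c : Fin m → A, X.Sat φ (Fin.append d c)
  | 0, φ, d => by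
    have h : ∀ c : Fin 0 → A, Fin.append d c = d := fun c => by
      funext i; exact Fin.append_left d c i
    simp only [exs, h]
    exact ⟨fun h => ⟨Fin.elim0, h⟩, fun ⟨_, h⟩ => h⟩
  | m + 1, φ, d => by
    simp only [exs]
    rw [sat_exs X]
    have h : ∀ (c : Fin m → A) (a : A), Fin.snoc (α := fun _ => A) (Fin.append d c) a =
        Fin.append d (Fin.snoc (α := fun _ => A) c a) := fun c a => (Fin.append_snoc d c a).symm
    constructor
    · rintro ⟨c, a, ha⟩
      exact ⟨Fin.snoc (α := fun _ => A) c a, by rw [← h]; exact ha⟩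
    · rintro ⟨c, hc⟩
      refine ⟨fun i => c i.castSucc, c (Fin.last m), ?_⟩
      have hs : Fin.snoc (α := fun _ => A) (fun i => c i.castSucc) (c (Fin.last m)) = c :=
        Fin.snoc_init_self c
      rw [h, hs]
      exact hc

theorem sound {T : RegTheory L} {X : Diagram L A} (hX : X.IsModel T) {n : ℕ}
    {φ ψ : RegFormula L n} (h : Provable T φ ψ) : ∀ d : Fin n → A, X.Sat φ d → X.Sat ψ d := by
  induction h with
  | ax σ hσ => exact hX σ hσ
  | refl φ => exact fun _ h => h
  | subst s _ ih =>
    intro d hd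
    rw [sat_subst] at hd ⊢
    exact ih _ hd
  | cut _ _ ih₁ ih₂ => exact fun d hd => ih₂ d (ih₁ d hd)
  | eq_refl i => exact fun d _ => X.setoid.refl _
  | eq_subst i j φ =>
    rintro d ⟨h₁, h₂⟩
    rw [sat_subst]
    refine X.sat_congr φ (fun k => ?_) h₂
    by_cases hk : k = i
    · subst hk
      rw [Function.update_self]
      exact h₁
    · simp [Function.update_of_ne hk]
  | top_intro φ => exact fun _ _ => trivial
  | and_left φ ψ => exact fun _ h => h.1
  | and_right φ ψ => exact fun _ h => h.2
  | and_intro _ _ ih₁ ih₂ => exact fun d hd => ⟨ih₁ d hd, ih₂ d hd⟩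
  | ex_elim _ ih =>
    rintro d ⟨a, ha⟩
    simpa [sat_subst] using ih _ ha
  | ex_intro _ ih =>
    intro d hd
    rw [sat_subst]
    refine ih _ ⟨d (Fin.last _), ?_⟩
    convert hd using 1
    exact Fin.snoc_init_self d
  | frobenius φ ψ =>
    rintro d ⟨h₁, a, ha⟩
    refine ⟨a, ?_, ha⟩
    rw [sat_subst]
    simpa using h₁

/-- The quotient of the domain of a diagram by the equivalence relation interpreting equality. -/
abbrev Quot (X : Diagram L A) : Type w := Quotient X.setoid

/-- The extension of a regular formula in the quotient structure of a diagram: the tuples of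
equivalence classes of tuples that satisfy the formula. -/
def ext (X : Diagram L A) {n : ℕ} (φ : RegFormula L n) : Set (Fin n → X.Quot) :=
  {a | ∃ d : Fin n → A, (fun i => (Quotient.mk X.setoid (d i) : X.Quot)) = a ∧ X.Sat φ d}

theorem mk_mem_ext (X : Diagram L A) {n : ℕ} (φ : RegFormula L n) (d : Fin n → A) :
    (fun i => (Quotient.mk X.setoid (d i) : X.Quot)) ∈ X.ext φ ↔ X.Sat φ d := by
  refine ⟨fun ⟨e, he, h⟩ => X.sat_congr φ (fun i => ?_) h, fun h => ⟨d, rfl, h⟩⟩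
  exact Quotient.exact (congrFun he i)

theorem append_mk_mem_ext (X : Diagram L A) {n m : ℕ} (φ : RegFormula L (n + m)) (d : Fin n → A)
    (e : Fin m → A) :
    Fin.append (fun i => (Quotient.mk X.setoid (d i) : X.Quot))
      (fun i => (Quotient.mk X.setoid (e i) : X.Quot)) ∈ X.ext φ ↔ X.Sat φ (Fin.append d e) := by
  rw [← mk_mem_ext, comp_append (g := fun a => (Quotient.mk X.setoid a : X.Quot))]

theorem exists_mk (X : Diagram L A) {n : ℕ} (a : Fin n → X.Quot) :
    ∃ d : Fin n → A, (fun i => (Quotient.mk X.setoid (d i) : X.Quot)) = a :=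
  ⟨fun i => (a i).out, funext fun i => Quotient.out_eq (a i)⟩

end Diagram

/-- A homomorphism of diagrams is a left-total relation that is closed under the equality of the
codomain and preserves facts. -/
@[ext]
structure DiagramHom {L : FirstOrder.Language.{u, u'}} {A : Type w} {B : Type w'}
    (X : Diagram L A) (Y : Diagram L B) where
  rel : A → B → Prop
  total : ∀ a, ∃ b, rel a b
  closed : ∀ a b b', rel a b → Y.setoid b b' → rel a b'
  preserves : ∀ (n : ℕ) (φ : RegFormula L n), φ.IsHorn → ∀ (d : Fin n → A) (e : Fin n → B),
    X.Sat φ d → (∀ i, rel (d i) (e i)) → Y.Sat φ e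

namespace DiagramHom

variable {L : FirstOrder.Language.{u, u'}} {A : Type w} {B : Type w'}
  {X : Diagram L A} {Y : Diagram L B}

theorem eq_of (h : DiagramHom X Y) {a a' : A} {b b' : B} (haa' : X.setoid a a') (hb : h.rel a b)
    (hb' : h.rel a' b') : Y.setoid b b' :=
  h.preserves 2 (eq 0 1) trivial ![a, a'] ![b, b'] haa'
    (fun i => by fin_cases i; exacts [hb, hb'])

theorem closed_left (h : DiagramHom X Y) {a a' : A} {b : B} (haa' : X.setoid a a')
    (hb : h.rel a' b) : h.rel a b := by
  obtain ⟨c, hc⟩ := h.total a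
  exact h.closed _ _ _ hc (h.eq_of haa' hc hb)

/-- The homomorphism induced by a function that preserves facts. -/
def ofFun (f : A → B)
    (hf : ∀ (n : ℕ) (φ : RegFormula L n), φ.IsHorn → ∀ d : Fin n → A, X.Sat φ d →
      Y.Sat φ fun i => f (d i)) : DiagramHom X Y where
  rel a b := Y.setoid (f a) b
  total a := ⟨f a, Y.setoid.refl _⟩
  closed _ _ _ h h' := Y.setoid.trans h h'
  preserves n φ hφ d _ hd h := Y.sat_congr φ h (hf n φ hφ d hd)

end DiagramHom

/-- A diagram bundled with its domain. -/
structure DiagramCat (L : FirstOrder.Language.{u, u'}) where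
  carrier : Type w
  str : Diagram L carrier

/-- The category of diagrams and homomorphisms of diagrams. -/
instance (L : FirstOrder.Language.{u, u'}) : Category.{w} (DiagramCat.{u, u', w} L) where
  Hom X Y := DiagramHom X.str Y.str
  id X := DiagramHom.ofFun (fun a => a) fun _ _ _ _ h => h
  comp {X Y Z} f g :=
    { rel := fun a c => ∃ b, f.rel a b ∧ g.rel b c
      total := fun a => by
        obtain ⟨b, hb⟩ := f.total a
        obtain ⟨c, hc⟩ := g.total b
        exact ⟨c, b, hb, hc⟩
      closed := fun _ _ _ ⟨b, hb, hc⟩ h => ⟨b, hb, g.closed _ _ _ hc h⟩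
      preserves := fun n φ hφ d e hd h => by
        choose b hb hc using h
        exact g.preserves n φ hφ b e (f.preserves n φ hφ d b hd hb) hc }
  id_comp f := by
    refine DiagramHom.ext (funext fun a => funext fun b => propext ⟨?_, fun h => ?_⟩)
    · rintro ⟨a', h, h'⟩
      exact f.closed_left h h'
    · exact ⟨a, Setoid.refl' _ a, h⟩
  comp_id f := by
    refine DiagramHom.ext (funext fun a => funext fun b => propext ⟨?_, fun h => ?_⟩)
    · rintro ⟨b', h, h'⟩
      exact f.closed _ _ _ h h'
    · exact ⟨b, h, Setoid.refl' _ b⟩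
  assoc f g h := by
    refine DiagramHom.ext (funext fun a => funext fun b => propext ⟨?_, ?_⟩)
    · rintro ⟨c, ⟨d, h₁, h₂⟩, h₃⟩
      exact ⟨d, h₁, c, h₂, h₃⟩
    · rintro ⟨c, h₁, d, h₂, h₃⟩
      exact ⟨d, ⟨c, h₁, h₂⟩, h₃⟩

/-- Diagrams whose domain is a subset of an ambient set `V`. -/
structure SubDiagram (L : FirstOrder.Language.{u, u'}) (V : Type v) where
  dom : Set V
  str : Diagram L dom

namespace SubDiagram

variable {L : FirstOrder.Language.{u, u'}} {V : Type v}

/-- The underlying object of the category of diagrams. -/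
abbrev toCat (X : SubDiagram L V) : DiagramCat.{u, u', v} L := ⟨X.dom, X.str⟩

/-- The subdiagram relation: inclusion of domains and of sets of facts. -/
instance : HasSubset (SubDiagram L V) where
  Subset X Y := ∃ h : X.dom ⊆ Y.dom, ∀ (n : ℕ) (φ : RegFormula L n), φ.IsHorn →
    ∀ d : Fin n → X.dom, X.str.Sat φ d → Y.str.Sat φ fun i => Set.inclusion h (d i)

/-- The homomorphism induced by an inclusion of diagrams. -/
def inclHom {X Y : SubDiagram L V} (h : X ⊆ Y) : X.toCat ⟶ Y.toCat :=
  DiagramHom.ofFun (Set.inclusion h.1) h.2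

theorem subset_refl (X : SubDiagram L V) : X ⊆ X := ⟨subset_rfl, fun _ _ _ _ h => h⟩

theorem subset_trans {X Y Z : SubDiagram L V} (h : X ⊆ Y) (h' : Y ⊆ Z) : X ⊆ Z :=
  ⟨h.1.trans h'.1, fun n φ hφ d hd => h'.2 n φ hφ _ (h.2 n φ hφ d hd)⟩

theorem subset_antisymm {X Y : SubDiagram L V} (h : X ⊆ Y) (h' : Y ⊆ X) : X = Y := by
  obtain ⟨D, ⟨s, r, c⟩⟩ := X
  obtain ⟨D', ⟨s', r', c'⟩⟩ := Y
  obtain rfl : D = D' := Set.Subset.antisymm h.1 h'.1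
  obtain rfl : s = s' := by
    ext a b
    exact ⟨fun hab => h.2 2 (eq 0 1) trivial ![a, b] hab,
      fun hab => h'.2 2 (eq 0 1) trivial ![a, b] hab⟩
  obtain rfl : @r = @r' := by
    funext k R a
    exact propext ⟨fun ha => h.2 k (rel R fun i => i) trivial a ha,
      fun ha => h'.2 k (rel R fun i => i) trivial a ha⟩
  rfl

theorem sat_of_subset {X Y : SubDiagram L V} (h : X ⊆ Y) {n : ℕ} (φ : RegFormula L n) :
    ∀ d : Fin n → X.dom, X.str.Sat φ d → Y.str.Sat φ fun i => Set.inclusion h.1 (d i) := by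
  induction φ with
  | top => intros; trivial
  | eq i j => exact h.2 _ (eq i j) trivial
  | rel R a => exact h.2 _ (rel R a) trivial
  | and φ ψ h₁ h₂ => exact fun d hd => ⟨h₁ d hd.1, h₂ d hd.2⟩
  | ex φ ih =>
    rintro d ⟨a, ha⟩
    refine ⟨Set.inclusion h.1 a, ?_⟩
    rw [← Diagram.comp_snoc]
    exact ih _ ha

/-- The empty diagram: the domain is empty and no propositional symbol holds. -/
def empty : SubDiagram L V where
  dom := ∅
  str :=
    { setoid := ⊥
      rel := fun _ _ => False
      rel_congr := fun _ _ _ _ h => h }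

end SubDiagram

/-- `Y` is the extension of the diagram `X` generated by finitely many new elements (the set
`Fin k`, enumerated, possibly with repetitions, by the list `c`) and one Horn fact `φ(d, c)` about
them and the list `d` of elements of `X`: it is the least diagram on the disjoint union of the
domain of `X` and `Fin k` that contains the facts of `X` and the fact `φ(d, c)`. -/
def IsFinitaryExtension {L : FirstOrder.Language.{u, u'}} {A : Type w} (X : Diagram L A)
    {n m k : ℕ} (φ : RegFormula L (n + m)) (d : Fin n → A) (c : Fin m → Fin k)
    (Y : Diagram L (A ⊕ Fin k)) : Prop :=
  φ.IsHorn ∧ Function.Surjective c ∧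
  IsLeast {Z : Diagram L (A ⊕ Fin k) |
    (∀ (l : ℕ) (ψ : RegFormula L l), ψ.IsHorn → ∀ a : Fin l → A, X.Sat ψ a →
      Z.Sat ψ fun i => Sum.inl (a i)) ∧
    Z.Sat φ (Fin.append (fun i => Sum.inl (d i)) fun i => Sum.inr (c i))} Y

/-- The homomorphism from a diagram to a finitary extension of it. -/
def IsFinitaryExtension.hom {L : FirstOrder.Language.{u, u'}} {A : Type w} {X : Diagram L A}
    {n m k : ℕ} {φ : RegFormula L (n + m)} {d : Fin n → A} {c : Fin m → Fin k}
    {Y : Diagram L (A ⊕ Fin k)} (h : IsFinitaryExtension X φ d c Y) :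
    (⟨A, X⟩ : DiagramCat.{u, u', w} L) ⟶ ⟨A ⊕ Fin k, Y⟩ :=
  DiagramHom.ofFun Sum.inl h.2.2.1.1

/-- The full subcategory of the category of diagrams on a set `S` of diagrams. -/
abbrev DiagramSubcat {L : FirstOrder.Language.{u, u'}} {V : Type v} (S : Set (SubDiagram L V)) :=
  InducedCategory (DiagramCat.{u, u', v} L) fun X : S => X.1.toCat

/-- A chase functor for `T` on a set `S` of diagrams. -/
structure IsChaseFunctor {L : FirstOrder.Language.{u, u'}} {V : Type v} (T : RegTheory L)
    (S : Set (SubDiagram L V)) (Ch : DiagramSubcat S ⥤ DiagramSubcat S) : Prop where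
  subset : ∀ X : S, X.1 ⊆ (Ch.obj X).1
  natural : ∀ {X Y : DiagramSubcat S} (f : X ⟶ Y),
    f.hom ≫ SubDiagram.inclHom (subset Y) = SubDiagram.inclHom (subset X) ≫ (Ch.map f).hom
  model : ∀ X : S, (Ch.obj X).1.str.IsModel T
  reflects : ∀ (X : S) (n : ℕ) (ψ : RegFormula L n) (d : Fin n → X.1.dom),
    (Ch.obj X).1.str.Sat ψ (fun i => Set.inclusion (subset X).1 (d i)) →
      ∃ φ : RegFormula L n, X.1.str.Sat φ d ∧ Provable T φ ψ

/-- Chase-complete sets of diagrams: the empty diagram is in `S`; `S` is closed under finitary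
extensions, up to an isomorphism under the diagram that is extended; `S` is closed under some chase
functor; and any finite list of diagrams in `S` has mutually disjoint isomorphic copies in `S`. -/
structure IsChaseComplete {L : FirstOrder.Language.{u, u'}} {V : Type v} (T : RegTheory L)
    (S : Set (SubDiagram L V)) : Prop where
  empty_mem : SubDiagram.empty ∈ S
  finitary : ∀ X ∈ S, ∀ {n m k : ℕ} (φ : RegFormula L (n + m)) (d : Fin n → X.dom)
    (c : Fin m → Fin k) (Y : Diagram L (X.dom ⊕ Fin k)) (hY : IsFinitaryExtension X.str φ d c Y),
    ∃ Z ∈ S, ∃ (h : X ⊆ Z) (i : (⟨_, Y⟩ : DiagramCat.{u, u', v} L) ≅ Z.toCat),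
      hY.hom ≫ i.hom = SubDiagram.inclHom h
  chase : ∃ Ch : DiagramSubcat S ⥤ DiagramSubcat S, IsChaseFunctor T S Ch
  disjoint_copies : ∀ (n : ℕ) (X : Fin n → SubDiagram L V), (∀ i, X i ∈ S) →
    ∃ Y : Fin n → SubDiagram L V, (∀ i, Y i ∈ S) ∧ (∀ i, Nonempty ((X i).toCat ≅ (Y i).toCat)) ∧
      Pairwise fun i j => Disjoint (Y i).dom (Y j).dom

/-- A set of model diagrams of `T` is chase-complete if it consists of the model diagrams in a
chase-complete set of diagrams. -/
def IsChaseCompleteModels {L : FirstOrder.Language.{u, u'}} {V : Type v} (T : RegTheory L)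
    (M : Set (SubDiagram L V)) : Prop :=
  ∃ S : Set (SubDiagram L V), IsChaseComplete T S ∧ M = {X | X ∈ S ∧ X.str.IsModel T}

theorem IsChaseCompleteModels.isModel {L : FirstOrder.Language.{u, u'}} {V : Type v}
    {T : RegTheory L} {M : Set (SubDiagram L V)} (hM : IsChaseCompleteModels T M) :
    ∀ X ∈ M, X.str.IsModel T := by
  obtain ⟨S, _, rfl⟩ := hM
  exact fun X hX => hX.2

/-- The elements of a set `M` of diagrams, ordered by inclusion of diagrams. -/
@[ext]
structure InclPoset {L : FirstOrder.Language.{u, u'}} {V : Type v} (M : Set (SubDiagram L V)) where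
  diagram : SubDiagram L V
  mem : diagram ∈ M

instance {L : FirstOrder.Language.{u, u'}} {V : Type v} (M : Set (SubDiagram L V)) :
    PartialOrder (InclPoset M) where
  le X Y := X.diagram ⊆ Y.diagram
  le_refl X := X.diagram.subset_refl
  le_trans _ _ _ := SubDiagram.subset_trans
  le_antisymm _ _ h h' := InclPoset.ext (SubDiagram.subset_antisymm h h')

namespace SubDiagram

variable {L : FirstOrder.Language.{u, u'}} {V : Type v}

/-- The map on quotients induced by an inclusion of diagrams. -/
def quotMap {X Y : SubDiagram L V} (h : X ⊆ Y) : X.str.Quot → Y.str.Quot :=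
  Quotient.map (Set.inclusion h.1) fun a b hab => h.2 2 (eq 0 1) trivial ![a, b] hab

theorem quotMap_mem_ext {X Y : SubDiagram L V} (h : X ⊆ Y) {n : ℕ} (φ : RegFormula L n)
    {a : Fin n → X.str.Quot} (ha : a ∈ X.str.ext φ) :
    (fun i => quotMap h (a i)) ∈ Y.str.ext φ := by
  obtain ⟨d, rfl, hd⟩ := ha
  exact ⟨_, rfl, sat_of_subset h φ d hd⟩

theorem quotMap_refl {X : SubDiagram L V} (h : X ⊆ X) (a : X.str.Quot) : quotMap h a = a := by
  induction a using Quotient.inductionOn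
  rfl

theorem quotMap_trans {X Y Z : SubDiagram L V} (h : X ⊆ Y) (h' : Y ⊆ Z) (h'' : X ⊆ Z)
    (a : X.str.Quot) : quotMap h'' a = quotMap h' (quotMap h a) := by
  induction a using Quotient.inductionOn
  rfl

end SubDiagram

namespace Diagram

variable {L : FirstOrder.Language.{u, u'}} {T : RegTheory L} {A : Type w}

/-- The graph of the function that a morphism of the syntactic category induces between the
extensions of formulas in a model diagram. -/
def graph {X : Diagram L A} (hX : X.IsModel T) {P Q : SynCat T} (f : P ⟶ Q)
    (a : Fin P.arity → X.Quot) (b : Fin Q.arity → X.Quot) : Prop :=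
  Quotient.liftOn f (fun θ => Fin.append a b ∈ X.ext θ.1) fun _ _ h => propext
    ⟨fun ⟨d, hd, h'⟩ => ⟨d, hd, sound hX h.1 d h'⟩, fun ⟨d, hd, h'⟩ => ⟨d, hd, sound hX h.2 d h'⟩⟩

theorem existsUnique_graph {X : Diagram L A} (hX : X.IsModel T) {P Q : SynCat T} (f : P ⟶ Q)
    (a : X.ext P.formula) : ∃! b : X.ext Q.formula, graph hX f a.1 b.1 := by
  obtain ⟨θ, hθ⟩ := f
  obtain ⟨_, d, rfl, hd⟩ := a
  obtain ⟨c, hc⟩ := (X.sat_exs θ d).1 (sound hX hθ.total d hd)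
  have hQ := (sound hX hθ.dom_cod _ hc).2
  rw [sat_subst] at hQ
  simp only [Fin.append_right] at hQ
  refine ⟨⟨_, c, rfl, hQ⟩, (X.append_mk_mem_ext θ d c).2 hc, ?_⟩
  rintro ⟨_, c', rfl, hc'⟩ h
  have h' : X.Sat θ (Fin.append d c') := (X.append_mk_mem_ext θ d c').1 h
  refine Subtype.ext (funext fun j => Quotient.sound ?_)
  have := sound hX (hθ.unique j) (Fin.append (Fin.append d c') c)
  simp only [Sat, sat_subst] at this
  rw [comp_append, comp_append] at this
  simp only [Fin.append_left, Fin.append_right] at this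
  exact this ⟨h', hc⟩

/-- The function that a morphism of the syntactic category induces between the extensions of
formulas in a model diagram. -/
noncomputable def extMap {X : Diagram L A} (hX : X.IsModel T) {P Q : SynCat T} (f : P ⟶ Q)
    (a : X.ext P.formula) : X.ext Q.formula :=
  (existsUnique_graph hX f a).choose

theorem extMap_eq_iff {X : Diagram L A} (hX : X.IsModel T) {P Q : SynCat T} (f : P ⟶ Q)
    (a : X.ext P.formula) (b : X.ext Q.formula) : extMap hX f a = b ↔ graph hX f a.1 b.1 :=
  ⟨fun h => h ▸ (existsUnique_graph hX f a).choose_spec.1,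
    fun h => ((existsUnique_graph hX f a).choose_spec.2 b h).symm⟩

theorem extMap_id {X : Diagram L A} (hX : X.IsModel T) (P : SynCat T) (a : X.ext P.formula) :
    extMap hX (𝟙 P) a = a := by
  rw [extMap_eq_iff]
  obtain ⟨_, d, rfl, hd⟩ := a
  refine (X.append_mk_mem_ext _ d d).2 ?_
  obtain ⟨c, hc⟩ := (X.sat_exs _ d).1 (sound hX (SynCat.isFunctional_graph P).total d hd)
  refine X.sat_congr _ (fun i => ?_) hc
  refine Fin.addCases (fun i => ?_) (fun i => ?_) i
  · simp
  · have h : Provable T (eqGraph P.formula)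
        (RegFormula.eq (Fin.natAdd P.arity i) (Fin.castAdd P.arity i)) :=
      (Provable.conj_elim (ψ := fun i => RegFormula.eq (Fin.castAdd P.arity i)
        (Fin.natAdd P.arity i)) (Provable.and_right _ _) i).eq_symm
    have := sound hX h _ hc
    simp only [Sat, Fin.append_left, Fin.append_right] at this
    rw [Fin.append_right, Fin.append_right]
    exact this

theorem extMap_comp {X : Diagram L A} (hX : X.IsModel T) {P Q R : SynCat T} (f : P ⟶ Q) (g : Q ⟶ R)
    (a : X.ext P.formula) : extMap hX (f ≫ g) a = extMap hX g (extMap hX f a) := by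
  rw [extMap_eq_iff]
  have hf := (extMap_eq_iff hX f a _).1 rfl
  have hg := (extMap_eq_iff hX g (extMap hX f a) _).1 rfl
  revert hf hg
  generalize extMap hX g (extMap hX f a) = c
  generalize extMap hX f a = b
  obtain ⟨θ, hθ⟩ := f
  obtain ⟨γ, hγ⟩ := g
  obtain ⟨_, d, rfl, hd⟩ := a
  obtain ⟨_, e, rfl, he⟩ := b
  obtain ⟨_, l, rfl, hl⟩ := c
  intro hf hg
  have hf' := (X.append_mk_mem_ext θ d e).1 hf
  have hg' := (X.append_mk_mem_ext γ e l).1 hg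
  refine (X.append_mk_mem_ext (RegFormula.comp θ γ) d l).2 ?_
  refine (X.sat_exs _ _).2 ⟨e, ?_, ?_⟩
  · rw [sat_subst, comp_append]
    simpa using hf'
  · rw [sat_subst, comp_append]
    simpa using hg'

end Diagram

theorem SubDiagram.extMap_quotMap {L : FirstOrder.Language.{u, u'}} {V : Type v} {T : RegTheory L}
    {X Y : SubDiagram L V} (hX : X.str.IsModel T) (hY : Y.str.IsModel T) (h : X ⊆ Y)
    {P Q : SynCat T} (f : P ⟶ Q) (a : X.str.ext P.formula) :
    Diagram.extMap hY f ⟨_, quotMap_mem_ext h P.formula a.2⟩ =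
      ⟨_, quotMap_mem_ext h Q.formula (Diagram.extMap hX f a).2⟩ := by
  rw [Diagram.extMap_eq_iff]
  have hf := (Diagram.extMap_eq_iff hX f a _).1 rfl
  revert hf
  generalize Diagram.extMap hX f a = b
  obtain ⟨θ, hθ⟩ := f
  intro hf
  have := quotMap_mem_ext h θ hf
  rw [comp_append] at this
  exact this

/-- The evaluation functor: it sends a formula-in-context `{x. φ}` to the functor which assigns to a
model diagram `X` in `M` the extension of `φ` in (the quotient structure of) `X`, and to an
inclusion of diagrams the induced function. -/
noncomputable def evaluationFunctor {L : FirstOrder.Language.{u, u'}} {V : Type v} (T : RegTheory L)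
    (M : Set (SubDiagram L V)) (hM : ∀ X ∈ M, X.str.IsModel T) :
    SynCat T ⥤ (InclPoset M ⥤ Type v) where
  obj P :=
    { obj := fun X => X.diagram.str.ext P.formula
      map := fun {X Y} h => TypeCat.ofHom fun a =>
        ⟨_, SubDiagram.quotMap_mem_ext (leOfHom h) P.formula a.2⟩
      map_id := fun X => by
        ext a i
        exact SubDiagram.quotMap_refl (leOfHom (𝟙 X)) (a.1 i)
      map_comp := fun f g => by
        ext a i
        exact (SubDiagram.quotMap_trans (leOfHom f) (leOfHom g) (leOfHom (f ≫ g)) (a.1 i)) }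
  map f :=
    { app := fun X => TypeCat.ofHom (Diagram.extMap (hM _ X.mem) f)
      naturality := fun X Y h => by
        ext a i
        exact congrFun (congrArg Subtype.val
          (SubDiagram.extMap_quotMap (hM _ X.mem) (hM _ Y.mem) (leOfHom h) f a)) i }
  map_id P := by
    ext X a i
    exact congrFun (congrArg Subtype.val (Diagram.extMap_id (hM _ X.mem) P a)) i
  map_comp f g := by
    ext X a i
    exact congrFun (congrArg Subtype.val (Diagram.extMap_comp (hM _ X.mem) f g a)) i

/-- A regular functor: it preserves finite limits and regular epimorphisms. -/
structure IsRegularFunctor {C : Type w} [Category.{w'} C] {D : Type x} [Category.{x'} D]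
    (F : C ⥤ D) : Prop where
  preservesFiniteLimits : PreservesFiniteLimits F
  map_regularEpi : ∀ {A B : C} (f : A ⟶ B), IsRegularEpi f → IsRegularEpi (F.map f)

/-- The subobject `F(S)` of `F(A)`, for a subobject `S` of `A` and a functor `F` that preserves
monomorphisms. -/
noncomputable def mapSubobject {C : Type w} [Category.{w'} C] {D : Type x} [Category.{x'} D]
    (F : C ⥤ D) [F.PreservesMonomorphisms] {A : C} (S : Subobject A) : Subobject (F.obj A) :=
  Subobject.mk (F.map S.arrow)

/-- A functor `F` is conditionally sub-Heyting if it is regular and preserves any right adjoints to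
pullback functors that exist: if the functor `f^* : Sub(B) ⥤ Sub(A)` has a right adjoint `∀_f`, then
so has `F(f)^*`, and `∀_{F(f)}(F(S)) = F(∀_f(S))` for all subobjects `S` of `A`. -/
structure IsConditionallySubHeyting {C : Type w} [Category.{w'} C] [Regular C]
    {D : Type x} [Category.{x'} D] [HasPullbacks D] (F : C ⥤ D) : Prop
    extends IsRegularFunctor F where
  map_forall : ∀ {A B : C} (f : A ⟶ B) (R : Subobject A ⥤ Subobject B),
    (Subobject.pullback f ⊣ R) →
    ∃ R' : Subobject (F.obj A) ⥤ Subobject (F.obj B),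
      Nonempty (Subobject.pullback (F.map f) ⊣ R') ∧
      haveI := preservesFiniteLimits
      ∀ S : Subobject A, R'.obj (mapSubobject F S) = mapSubobject F (R.obj S)

end RegLogic

open RegLogic

namespace RegLogic

open RegFormula

variable {L : FirstOrder.Language.{u, u'}}

namespace Provable

variable {T : RegTheory L}

/-- Existential quantification over a block of variables may be weakened along a derivation that
chooses witnesses. -/
theorem exs_le {n m : ℕ} {φ : RegFormula L (n + m)} {ψ : RegFormula L n}
    (h : ∀ {k : ℕ} (χ : RegFormula L k) (e : Fin n → Fin k) (f : Fin m → Fin k),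
      Provable T χ (φ.subst (Fin.append e f)) → Provable T χ (ψ.subst e)) :
    Provable T (exs m φ) ψ :=
  exs_elim' (φ := φ) (fun i => i) (by rw [subst_id]; exact refl _)
    fun χ s f _ hf => h χ s f hf

theorem ex_intro_var {n k : ℕ} {φ : RegFormula L (n + 1)} {χ : RegFormula L k} (e : Fin n → Fin k)
    (i : Fin k) (h : Provable T χ (φ.subst (Fin.snoc (α := fun _ => Fin k) e i))) :
    Provable T χ ((ex φ).subst e) := by
  refine exs_intro (m := 1) (φ := φ) e (fun _ => i) ?_
  rw [Fin.append_right_eq_snoc]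
  exact h

theorem exs_exs {n m l : ℕ} (θ : RegFormula L (n + m + l)) :
    Provable T (exs m (exs l θ)) (exs (m + l) (θ.subst (Fin.cast (Nat.add_assoc n m l)))) ∧
      Provable T (exs (m + l) (θ.subst (Fin.cast (Nat.add_assoc n m l)))) (exs m (exs l θ)) := by
  constructor
  · refine exs_le fun χ e f h => ?_
    refine exs_elim' _ h fun χ' s g _ hg => ?_
    rw [subst_subst]
    refine exs_intro _ (Fin.append (fun i => s (f i)) g) ?_
    rw [subst_subst]
    rw [comp_append, Fin.append_assoc] at hg
    exact hg
  · refine exs_le fun χ e f h => ?_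
    obtain ⟨f₁, f₂, rfl⟩ : ∃ f₁ f₂, f = Fin.append f₁ f₂ :=
      ⟨_, _, (Fin.append_castAdd_natAdd (f := f)).symm⟩
    refine exs_intro _ f₁ (exs_intro _ f₂ ?_)
    rw [subst_subst] at h
    rw [Fin.append_assoc]
    exact h

end Provable

namespace RegFormula

theorem IsHorn.subst {n : ℕ} {φ : RegFormula L n} (h : φ.IsHorn) {m : ℕ} (s : Fin n → Fin m) :
    (φ.subst s).IsHorn := by
  induction φ generalizing m with
  | top => trivial
  | eq i j => trivial
  | rel R a => trivial
  | and φ ψ h₁ h₂ => exact ⟨h₁ h.1 s, h₂ h.2 s⟩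
  | ex φ => exact h.elim

/-- Every regular formula is provably equivalent to an existentially quantified Horn formula. -/
theorem exists_prenex {n : ℕ} (φ : RegFormula L n) :
    ∃ (m : ℕ) (θ : RegFormula L (n + m)), θ.IsHorn ∧ ∀ T : RegTheory L,
      Provable T φ (exs m θ) ∧ Provable T (exs m θ) φ := by
  induction φ with
  | top => exact ⟨0, top, trivial, fun _ => ⟨.refl _, .refl _⟩⟩
  | eq i j => exact ⟨0, eq i j, trivial, fun _ => ⟨.refl _, .refl _⟩⟩
  | rel R a => exact ⟨0, rel R a, trivial, fun _ => ⟨.refl _, .refl _⟩⟩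
  | @and n φ ψ h₁ h₂ =>
    obtain ⟨m, θ, hθ, h₁⟩ := h₁
    obtain ⟨l, γ, hγ, h₂⟩ := h₂
    refine ⟨m + l, and
      (θ.subst (Fin.append (fun i => Fin.castAdd (m + l) i)
        (fun j => Fin.natAdd n (Fin.castAdd l j))))
      (γ.subst (Fin.append (fun i => Fin.castAdd (m + l) i)
        (fun j => Fin.natAdd n (Fin.natAdd m j)))), ⟨hθ.subst _, hγ.subst _⟩, fun T => ⟨?_, ?_⟩⟩
    · refine Provable.exs_elim' (φ := θ) (fun i => i)
        (by rw [subst_id]; exact (Provable.and_left _ _).cut (h₁ T).1) fun χ s f hs hf => ?_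
      refine Provable.exs_elim' (φ := γ) s
        (hs.cut ((Provable.and_right _ _).cut ((h₂ T).1.subst s))) fun χ' s' g hs' hg => ?_
      rw [subst_subst]
      refine Provable.exs_intro _ (Fin.append (fun i => s' (f i)) g) ?_
      simp only [RegFormula.subst, subst_subst, comp_append, Fin.append_left, Fin.append_right]
      exact Provable.and_intro (Provable.mono₂ hs' hf) hg
    · refine Provable.exs_le fun χ e f h => ?_
      simp only [RegFormula.subst, subst_subst, comp_append, Fin.append_left,
        Fin.append_right] at h
      exact Provable.and_intro
        ((Provable.exs_intro _ _ (h.cut (Provable.and_left _ _))).cut ((h₁ T).2.subst e))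
        ((Provable.exs_intro _ _ (h.cut (Provable.and_right _ _))).cut ((h₂ T).2.subst e))
  | @ex n φ ih =>
    obtain ⟨m, θ, hθ, h⟩ := ih
    refine ⟨1 + m, θ.subst (Fin.cast (Nat.add_assoc n 1 m)), hθ.subst _, fun T => ?_⟩
    have key : ∀ {α β : RegFormula L (n + 1)}, Provable T α β → Provable T (ex α) (ex β) :=
      fun h' => Provable.ex_elim (h'.cut (Provable.ex_intro (Provable.refl _)))
    exact ⟨(key (h T).1).cut (Provable.exs_exs θ).1, (Provable.exs_exs θ).2.cut (key (h T).2)⟩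

end RegFormula

/-- A finite context with a hypothesis, in which the elements of a set `B` are named by
variables. -/
structure World (L : FirstOrder.Language.{u, u'}) (B : Type w) where
  arity : ℕ
  hyp : RegFormula L arity
  val : B → Fin arity

/-- The world `W` proves the formula `φ` about elements of `B`. -/
def World.Forces {B : Type w} (T : RegTheory L) (W : World L B) {n : ℕ} (φ : RegFormula L n)
    (e : Fin n → B) : Prop :=
  Provable T W.hyp (φ.subst fun i => W.val (e i))

namespace Diagram

variable {A : Type w} {B : Type w'}

/-- The diagram of the atomic facts that hold eventually along a filter of worlds. -/
def generic (T : RegTheory L) (F : Filter (World L B)) : Diagram L B where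
  setoid :=
    { r := fun a b => ∀ᶠ W in F, Provable T W.hyp (eq (W.val a) (W.val b))
      iseqv :=
        ⟨fun _ => .of_forall fun _ => (Provable.top_intro _).cut (Provable.eq_refl _),
          fun {a b} (h : ∀ᶠ W in F, Provable T W.hyp (RegFormula.eq (W.val a) (W.val b))) =>
            h.mono fun _ h => h.eq_symm,
          fun {a b c} (h : ∀ᶠ W in F, Provable T W.hyp (RegFormula.eq (W.val a) (W.val b)))
              (h' : ∀ᶠ W in F, Provable T W.hyp (RegFormula.eq (W.val b) (W.val c))) =>
            (h.and h').mono fun _ h => h.1.eq_trans h.2⟩ }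
  rel R a := ∀ᶠ W in F, Provable T W.hyp (RegFormula.rel R fun i => W.val (a i))
  rel_congr R a b h h' := by
    have h := Filter.eventually_all.2 h
    filter_upwards [h, h'] with W h h'
    exact Provable.leibniz (RegFormula.rel R fun i => i) _ _ h h'

theorem generic_sat_of_isHorn (T : RegTheory L) (F : Filter (World L B)) {n : ℕ}
    {φ : RegFormula L n} (hφ : φ.IsHorn) (e : Fin n → B) (h : ∀ᶠ W in F, W.Forces T φ e) :
    (generic T F).Sat φ e := by
  induction φ with
  | top => trivial
  | eq i j => exact h
  | rel R a => exact h
  | and φ ψ h₁ h₂ =>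
    exact ⟨h₁ hφ.1 e (h.mono fun _ h => h.cut (Provable.and_left _ _)),
      h₂ hφ.2 e (h.mono fun _ h => h.cut (Provable.and_right _ _))⟩
  | ex φ => exact hφ.elim

theorem forces_of_generic_sat (T : RegTheory L) (F : Filter (World L B)) {n : ℕ}
    (φ : RegFormula L n) (e : Fin n → B) (h : (generic T F).Sat φ e) :
    ∀ᶠ W in F, W.Forces T φ e := by
  induction φ with
  | top => exact .of_forall fun _ => Provable.top_intro _
  | eq i j => exact h
  | rel R a => exact h
  | and φ ψ h₁ h₂ =>
    exact ((h₁ e h.1).and (h₂ e h.2)).mono fun _ h => Provable.and_intro h.1 h.2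
  | ex φ ih =>
    obtain ⟨a, ha⟩ := h
    refine (ih _ ha).mono fun W h => Provable.ex_intro_var _ (W.val a) ?_
    rw [← comp_snoc]
    exact h

/-- Conditions on worlds that follow from finitely many facts of `X` and the fact `θ(b)`. -/
def condFilter (T : RegTheory L) (X : Diagram L A) (g : A → B) {m : ℕ} (θ : RegFormula L m)
    (b : Fin m → B) : Filter (World L B) where
  sets := {U | ∃ (p : ℕ) (a : Fin p → A) (γ : RegFormula L p), X.Sat γ a ∧
    ∀ W : World L B, W.Forces T γ (fun i => g (a i)) → W.Forces T θ b → W ∈ U}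
  univ_sets := ⟨0, Fin.elim0, top, trivial, fun _ _ _ => trivial⟩
  sets_of_superset := fun ⟨p, a, γ, h, h'⟩ hU => ⟨p, a, γ, h, fun W h₁ h₂ => hU (h' W h₁ h₂)⟩
  inter_sets := by
    rintro U V ⟨p, a, γ, h, h'⟩ ⟨q, c, δ, k, k'⟩
    refine ⟨p + q, Fin.append a c, and (γ.subst (Fin.castAdd q)) (δ.subst (Fin.natAdd p)),
      ⟨?_, ?_⟩, fun W h₁ h₂ => ⟨h' W ?_ h₂, k' W ?_ h₂⟩⟩
    · rw [sat_subst]; simpa using h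
    · rw [sat_subst]; simpa using k
    · have := h₁.cut (Provable.and_left _ _)
      simpa [World.Forces, subst_subst] using this
    · have := h₁.cut (Provable.and_right _ _)
      simpa [World.Forces, subst_subst] using this

/-- Homomorphisms that are given by the identity preserve regular formulas. -/
theorem sat_of_le {X Y : Diagram L A} (h : X ≤ Y) {n : ℕ} (φ : RegFormula L n) :
    ∀ d : Fin n → A, X.Sat φ d → Y.Sat φ d := by
  induction φ with
  | top => intros; trivial
  | eq i j => exact h _ (eq i j) trivial
  | rel R a => exact h _ (RegFormula.rel R a) trivial
  | and φ ψ h₁ h₂ => exact fun d hd => ⟨h₁ d hd.1, h₂ d hd.2⟩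
  | ex φ ih => exact fun d ⟨a, ha⟩ => ⟨a, ih _ ha⟩

/-- The intersection of a set of diagrams. -/
def inter (s : Set (Diagram L A)) : Diagram L A where
  setoid :=
    { r := fun a b => ∀ X ∈ s, X.setoid a b
      iseqv := ⟨fun _ X _ => X.setoid.refl _, fun h X hX => X.setoid.symm (h X hX),
        fun h h' X hX => X.setoid.trans (h X hX) (h' X hX)⟩ }
  rel R a := ∀ X ∈ s, X.rel R a
  rel_congr R a b h h' X hX := X.rel_congr R a b (fun i => h i X hX) (h' X hX)

theorem inter_sat {s : Set (Diagram L A)} {n : ℕ} {φ : RegFormula L n} (hφ : φ.IsHorn)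
    (d : Fin n → A) : (inter s).Sat φ d ↔ ∀ X ∈ s, X.Sat φ d := by
  induction φ with
  | top => exact ⟨fun _ _ _ => trivial, fun _ => trivial⟩
  | eq i j => rfl
  | rel R a => rfl
  | and φ ψ h₁ h₂ =>
    exact (and_congr (h₁ hφ.1 d) (h₂ hφ.2 d)).trans
      ⟨fun h X hX => ⟨h.1 X hX, h.2 X hX⟩, fun h => ⟨fun X hX => (h X hX).1, fun X hX => (h X hX).2⟩⟩
  | ex φ => exact hφ.elim

theorem exists_isFinitaryExtension (X : Diagram L A) {n m k : ℕ} {φ : RegFormula L (n + m)}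
    (hφ : φ.IsHorn) (d : Fin n → A) {c : Fin m → Fin k} (hc : Function.Surjective c) :
    ∃ Y, IsFinitaryExtension X φ d c Y :=
  ⟨inter _, hφ, hc, ⟨fun l ψ hψ a ha => (inter_sat hψ _).2 fun _ hZ => hZ.1 l ψ hψ a ha,
    (inter_sat hφ _).2 fun _ hZ => hZ.2⟩,
    fun _ hZ _ _ hψ _ h => (inter_sat hψ _).1 h _ hZ⟩

end Diagram

theorem DiagramHom.sat {A : Type w} {B : Type w'} {X : Diagram L A} {Y : Diagram L B}
    (h : DiagramHom X Y) {n : ℕ} (φ : RegFormula L n) :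
    ∀ (d : Fin n → A) (e : Fin n → B), X.Sat φ d → (∀ i, h.rel (d i) (e i)) → Y.Sat φ e := by
  induction φ with
  | top => intros; trivial
  | eq i j => exact h.preserves _ (eq i j) trivial
  | rel R a => exact h.preserves _ (RegFormula.rel R a) trivial
  | and φ ψ h₁ h₂ => exact fun d e hd hde => ⟨h₁ d e hd.1 hde, h₂ d e hd.2 hde⟩
  | ex φ ih =>
    rintro d e ⟨a, ha⟩ hde
    obtain ⟨b, hb⟩ := h.total a
    refine ⟨b, ih _ _ ha fun i => ?_⟩
    refine Fin.lastCases ?_ (fun i => ?_) i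
    · simpa using hb
    · simpa using hde i

namespace IsFinitaryExtension

variable {A : Type w} {X : Diagram L A}

/-- A regular formula that holds in a finitary extension is a consequence of the fact that was
added and finitely many facts of the diagram that was extended. -/
theorem exists_forces (T : RegTheory L) {n m k : ℕ} {θ : RegFormula L (n + m)} {d : Fin n → A}
    {c : Fin m → Fin k} {Y : Diagram L (A ⊕ Fin k)} (hY : IsFinitaryExtension X θ d c Y) {l : ℕ}
    (ψ : RegFormula L l) (e : Fin l → A ⊕ Fin k) (h : Y.Sat ψ e) :
    ∃ (p : ℕ) (a : Fin p → A) (γ : RegFormula L p), X.Sat γ a ∧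
      ∀ W : World L (A ⊕ Fin k), W.Forces T γ (fun i => Sum.inl (a i)) →
        W.Forces T θ (Fin.append (fun i => Sum.inl (d i)) fun i => Sum.inr (c i)) →
        W.Forces T ψ e := by
  let F := Diagram.condFilter T X Sum.inl θ
    (Fin.append (fun i => Sum.inl (d i)) fun i => Sum.inr (c i))
  have hle : Y ≤ Diagram.generic T F := by
    refine hY.2.2.2 ⟨fun l ψ hψ a ha => ?_, ?_⟩
    · exact Diagram.generic_sat_of_isHorn T F hψ _ ⟨l, a, ψ, ha, fun _ h _ => h⟩
    · exact Diagram.generic_sat_of_isHorn T F hY.1 _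
        ⟨0, Fin.elim0, top, trivial, fun _ _ h => h⟩
  exact Diagram.forces_of_generic_sat T F ψ e (Diagram.sat_of_le hle ψ e h)

theorem exists_formula (T : RegTheory L) {n m : ℕ} {θ : RegFormula L (n + m)} {d : Fin n → A}
    {Y : Diagram L (A ⊕ Fin m)} (hY : IsFinitaryExtension X θ d (fun i => i) Y)
    (ψ : RegFormula L (n + m)) (h : Y.Sat ψ (Fin.append (fun i => Sum.inl (d i)) Sum.inr)) :
    ∃ δ : RegFormula L n, X.Sat δ d ∧ Provable T (and (δ.subst (Fin.castAdd m)) θ) ψ := by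
  classical
  obtain ⟨p, a, γ, hp, hγ, H⟩ : ∃ (p : ℕ) (a : Fin p → A) (γ : RegFormula L p),
      (Nonempty A → 0 < p) ∧ X.Sat γ a ∧
      ∀ W : World L (A ⊕ Fin m), W.Forces T γ (fun i => Sum.inl (a i)) →
        W.Forces T θ (Fin.append (fun i => Sum.inl (d i)) fun i => Sum.inr i) →
        W.Forces T ψ (Fin.append (fun i => Sum.inl (d i)) Sum.inr) := by
    obtain ⟨p, a, γ, hγ, H⟩ := hY.exists_forces T ψ _ h
    rcases isEmpty_or_nonempty A with hA | ⟨⟨a₀⟩⟩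
    · exact ⟨p, a, γ, fun h => (not_nonempty_iff.2 hA h).elim, hγ, H⟩
    · refine ⟨p + 1, Fin.snoc (α := fun _ => A) a a₀, γ.subst Fin.castSucc,
        fun _ => p.succ_pos, ?_, fun W hW => H W ?_⟩
      · rw [Diagram.sat_subst]; simpa using hγ
      · simpa [World.Forces, subst_subst] using hW
  let a' : Fin (n + p) → A := Fin.append d a
  let E : RegFormula L (n + p) := conj fun i => conj fun j => if a' i = a' j then eq i j else top
  refine ⟨exs p (and (γ.subst (Fin.natAdd n)) E), ?_, ?_⟩
  · refine (X.sat_exs _ _).2 ⟨a, ?_, ?_⟩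
    · rw [Diagram.sat_subst]; simpa using hγ
    · have key : ∀ {q : ℕ} (ψ : Fin q → RegFormula L (n + p)), (∀ i, X.Sat (ψ i) a') →
          X.Sat (conj ψ) a' := by
        intro q
        induction q with
        | zero => intros; trivial
        | succ q ih => exact fun ψ hψ => ⟨ih _ fun i => hψ _, hψ _⟩
      refine key _ fun i => key _ fun j => ?_
      split_ifs with hij
      · simp only [Diagram.Sat, hij]
        exact X.setoid.refl _
      · trivial
  · refine Provable.exs_elim' _ (Provable.and_left _ _) fun {k'} χ s f hs hf => ?_
    let g : Fin (n + p) → Fin k' := Fin.append (fun i => s (Fin.castAdd m i)) f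
    have hE : ∀ i j, a' i = a' j → Provable T χ (eq (g i) (g j)) := by
      intro i j hij
      have h₁ : Provable T χ (E.subst g) := hf.cut (Provable.and_right _ _)
      rw [conj_subst] at h₁
      have h₂ := Provable.conj_elim h₁ i
      rw [conj_subst] at h₂
      have h₃ := Provable.conj_elim h₂ j
      rw [if_pos hij] at h₃
      exact h₃
    have hγ' : Provable T χ (γ.subst fun i => g (Fin.natAdd n i)) := by
      have := hf.cut (Provable.and_left _ _)
      rwa [subst_subst] at this
    obtain ⟨v, hv⟩ : ∃ v : A → Fin k', ∀ i, Provable T χ (eq (g i) (v (a' i))) := by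
      rcases isEmpty_or_nonempty A with hA | hA
      · exact ⟨isEmptyElim, fun i => isEmptyElim (a' i)⟩
      · refine ⟨fun x => if hx : ∃ i, a' i = x then g hx.choose else f ⟨0, hp hA⟩, fun i => ?_⟩
        have hi : ∃ j, a' j = a' i := ⟨i, rfl⟩
        simp only [dif_pos hi]
        exact hE _ _ hi.choose_spec.symm
    have hs' : ∀ i : Fin (n + m), Provable T χ (eq (s i) (Sum.elim v
        (fun j => s (Fin.natAdd n j)) (Fin.append (fun i => Sum.inl (d i)) Sum.inr i))) := by
      intro i
      refine Fin.addCases (fun i => ?_) (fun i => ?_) i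
      · simpa [g, a'] using hv (Fin.castAdd p i)
      · simpa using (Provable.top_intro _).cut (Provable.eq_refl _)
    have := H ⟨k', χ, Sum.elim v fun j => s (Fin.natAdd n j)⟩
      (Provable.leibniz γ _ _ (fun i => by simpa [a'] using hv (Fin.natAdd n i)) hγ')
      (Provable.leibniz θ _ _ hs' (hs.cut (Provable.and_right _ _)))
    exact Provable.leibniz ψ _ _ (fun i => (hs' i).eq_symm) this

end IsFinitaryExtension

namespace IsChaseComplete

variable {V : Type v} {T : RegTheory L} {S : Set (SubDiagram L V)}

/-- If `φ(b, x)` entails `σ(b, x)` in all model diagrams in `S` that extend `X`, then this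
entailment is provable from a formula that `b` satisfies in `X`. -/
theorem exists_formula (hS : IsChaseComplete T S) {X : SubDiagram L V} (hX : X ∈ S) {n m : ℕ}
    (b : Fin n → X.dom) (φ σ : RegFormula L (n + m))
    (h : ∀ Y ∈ S, Y.str.IsModel T → ∀ (hXY : X ⊆ Y) (c : Fin m → Y.dom),
      Y.str.Sat φ (Fin.append (fun i => Set.inclusion hXY.1 (b i)) c) →
      Y.str.Sat σ (Fin.append (fun i => Set.inclusion hXY.1 (b i)) c)) :
    ∃ δ : RegFormula L n, X.str.Sat δ b ∧ Provable T (and (δ.subst (Fin.castAdd m)) φ) σ := by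
  obtain ⟨l, θ, hθ, hφθ⟩ := φ.exists_prenex
  let θ' : RegFormula L (n + (m + l)) := θ.subst (Fin.cast (Nat.add_assoc n m l))
  obtain ⟨Y, hY⟩ := X.str.exists_isFinitaryExtension (hθ.subst (Fin.cast (Nat.add_assoc n m l))) b
    (c := fun i : Fin (m + l) => i) Function.surjective_id
  obtain ⟨Z, hZ, hXZ, i, hi⟩ := hS.finitary X hX _ b _ Y hY
  obtain ⟨Ch, hCh⟩ := hS.chase
  choose z hz using fun j : Fin (m + l) => DiagramHom.total i.hom (Sum.inr j)
  have hb : ∀ j, i.hom.rel (Sum.inl (b j)) (Set.inclusion hXZ.1 (b j)) := by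
    intro j
    have h₁ : (SubDiagram.inclHom hXZ).rel (b j) (Set.inclusion hXZ.1 (b j)) :=
      Z.str.setoid.refl _
    rw [← hi] at h₁
    obtain ⟨y, hy, hy'⟩ := h₁
    exact i.hom.closed_left hy hy'
  have hinv : ∀ y z, i.hom.rel y z → i.inv.rel z y := by
    intro y z hyz
    obtain ⟨y', hy'⟩ := DiagramHom.total i.inv z
    have h₁ : (i.hom ≫ i.inv).rel y y' := ⟨z, hyz, hy'⟩
    rw [i.hom_inv_id] at h₁
    exact i.inv.closed _ _ _ hy' (Y.setoid.symm h₁)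
  have hZθ : Z.str.Sat θ' (Fin.append (fun j => Set.inclusion hXZ.1 (b j)) z) := by
    refine DiagramHom.sat i.hom _ _ _ hY.2.2.1.2 fun j => ?_
    refine Fin.addCases (fun j => ?_) (fun j => ?_) j
    · simpa using hb j
    · simpa using hz j
  have hZφ : Z.str.Sat φ (Fin.append (fun j => Set.inclusion hXZ.1 (b j))
      fun j => z (Fin.castAdd l j)) := by
    refine Diagram.sound (T := ∅) (fun _ h => h.elim) (hφθ ∅).2 _ ?_
    refine (Z.str.sat_exs _ _).2 ⟨fun j => z (Fin.natAdd m j), ?_⟩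
    rw [Diagram.sat_subst] at hZθ
    rw [Fin.append_assoc, Fin.append_castAdd_natAdd]
    exact hZθ
  have hZC : Z ⊆ (Ch.obj ⟨Z, hZ⟩).1 := hCh.subset ⟨Z, hZ⟩
  have hCσ := h (Ch.obj ⟨Z, hZ⟩).1 (Ch.obj ⟨Z, hZ⟩).2 (hCh.model ⟨Z, hZ⟩)
    (SubDiagram.subset_trans hXZ hZC)
    (fun j => Set.inclusion hZC.1 (z (Fin.castAdd l j))) (by
      have := SubDiagram.sat_of_subset hZC φ _ hZφ
      rw [comp_append] at this
      exact this)
  obtain ⟨ρ, hρ, hρσ⟩ := hCh.reflects ⟨Z, hZ⟩ (n + m) σ (Fin.append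
    (fun j => Set.inclusion hXZ.1 (b j)) fun j => z (Fin.castAdd l j)) (by
      rw [comp_append]
      exact hCσ)
  have hYρ : Y.Sat ρ (Fin.append (fun j => Sum.inl (b j)) fun j => Sum.inr (Fin.castAdd l j)) := by
    refine DiagramHom.sat i.inv _ _ _ hρ fun j => ?_
    refine Fin.addCases (fun j => ?_) (fun j => ?_) j
    · simpa using hinv _ _ (hb j)
    · simpa using hinv _ _ (hz (Fin.castAdd l j))
  obtain ⟨δ, hδ, hδρ⟩ := hY.exists_formula T (ρ.subst (Fin.append (fun j => Fin.castAdd (m + l) j)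
    fun j => Fin.natAdd n (Fin.castAdd l j))) (by
      rw [Diagram.sat_subst, comp_append]
      simpa using hYρ)
  refine ⟨δ, hδ, ?_⟩
  refine Provable.exs_elim' (φ := θ) (fun i => i)
    (by rw [subst_id]; exact (Provable.and_right _ _).cut (hφθ T).1) fun {k} χ s f hs hf => ?_
  refine Provable.cut ?_ (hρσ.subst s)
  obtain ⟨s₁, s₂, rfl⟩ : ∃ s₁ s₂, s = Fin.append s₁ s₂ :=
    ⟨_, _, (Fin.append_castAdd_natAdd (f := s)).symm⟩
  have h₁ := hδρ.mp (Fin.append s₁ (Fin.append s₂ f)) (χ := χ)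
  simp only [RegFormula.subst, subst_subst, comp_append, Fin.append_left, Fin.append_right] at h₁ hs
  refine h₁ (Provable.and_intro (hs.cut (Provable.and_left _ _)) ?_)
  rw [Fin.append_assoc] at hf
  exact hf

end IsChaseComplete

theorem SubDiagram.provable_of_empty_sat {V : Type v} (T : RegTheory L) {n : ℕ}
    (φ : RegFormula L n) (d : Fin n → (SubDiagram.empty : SubDiagram L V).dom)
    (h : (SubDiagram.empty : SubDiagram L V).str.Sat φ d) : Provable T top φ := by
  induction φ with
  | top => exact .refl _
  | eq i j => exact (d i).2.elim
  | rel R a => exact h.elim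
  | and φ ψ h₁ h₂ => exact .and_intro (h₁ d h.1) (h₂ d h.2)
  | ex φ => exact h.choose.2.elim

namespace IsChaseCompleteModels

variable {V : Type v} {T : RegTheory L} {M : Set (SubDiagram L V)}

theorem exists_formula (hM : IsChaseCompleteModels T M) {X : SubDiagram L V} (hX : X ∈ M)
    {n m : ℕ} (b : Fin n → X.dom) (φ σ : RegFormula L (n + m))
    (h : ∀ Y ∈ M, ∀ (hXY : X ⊆ Y) (c : Fin m → Y.dom),
      Y.str.Sat φ (Fin.append (fun i => Set.inclusion hXY.1 (b i)) c) →
      Y.str.Sat σ (Fin.append (fun i => Set.inclusion hXY.1 (b i)) c)) :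
    ∃ δ : RegFormula L n, X.str.Sat δ b ∧ Provable T (and (δ.subst (Fin.castAdd m)) φ) σ := by
  obtain ⟨S, hS, rfl⟩ := hM
  exact hS.exists_formula hX.1 b φ σ fun Y hY hYT => h Y ⟨hY, hYT⟩

/-- Completeness: a sequent that holds in all elements of a chase-complete set of model diagrams is
provable. -/
theorem complete (hM : IsChaseCompleteModels T M) {n : ℕ} {φ ψ : RegFormula L n}
    (h : ∀ X ∈ M, ∀ d : Fin n → X.dom, X.str.Sat φ d → X.str.Sat ψ d) : Provable T φ ψ := by
  obtain ⟨S, hS, rfl⟩ := hM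
  have hd : ∀ {Y : SubDiagram L V} (b : Fin 0 → Y.dom) (c : Fin n → Y.dom),
      (fun i => Fin.append b c (Fin.natAdd 0 i)) = c := fun b c => by
    funext i; exact Fin.append_right b c i
  obtain ⟨δ, hδ, H⟩ := hS.exists_formula hS.empty_mem (m := n) Fin.elim0
    (φ.subst (Fin.natAdd 0)) (ψ.subst (Fin.natAdd 0)) fun Y hY hYT hXY c hc => by
      rw [Diagram.sat_subst, hd] at hc ⊢
      exact h Y ⟨hY, hYT⟩ c hc
  have hδ' := SubDiagram.provable_of_empty_sat T δ _ hδ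
  have h₁ := H.mp (Fin.append Fin.elim0 fun i => i) (χ := φ)
  simp only [RegFormula.subst, subst_subst, Fin.append_left, Fin.append_right, subst_id] at h₁
  exact h₁ (.and_intro ((Provable.top_intro _).cut (hδ'.subst _)) (.refl _))

end IsChaseCompleteModels

namespace Diagram

variable {A : Type w} (X : Diagram L A)

theorem subst_mem_ext {n m : ℕ} {φ : RegFormula L n} {s : Fin n → Fin m} {a : Fin m → X.Quot} :
    a ∈ X.ext (φ.subst s) ↔ (fun i => a (s i)) ∈ X.ext φ := by
  obtain ⟨d, rfl⟩ := X.exists_mk a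
  rw [mk_mem_ext, sat_subst]
  exact (X.mk_mem_ext φ fun i => d (s i)).symm

theorem and_mem_ext {n : ℕ} {φ ψ : RegFormula L n} {a : Fin n → X.Quot} :
    a ∈ X.ext (and φ ψ) ↔ a ∈ X.ext φ ∧ a ∈ X.ext ψ := by
  obtain ⟨d, rfl⟩ := X.exists_mk a
  simp only [mk_mem_ext]
  rfl

theorem exs_mem_ext {n m : ℕ} {φ : RegFormula L (n + m)} {a : Fin n → X.Quot} :
    a ∈ X.ext (exs m φ) ↔ ∃ c, Fin.append a c ∈ X.ext φ := by
  obtain ⟨d, rfl⟩ := X.exists_mk a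
  rw [mk_mem_ext, sat_exs]
  constructor
  · rintro ⟨c, hc⟩
    exact ⟨_, (X.append_mk_mem_ext φ d c).2 hc⟩
  · rintro ⟨c, hc⟩
    obtain ⟨c, rfl⟩ := X.exists_mk c
    exact ⟨c, (X.append_mk_mem_ext φ d c).1 hc⟩

theorem conj_eq_mem_ext {n m : ℕ} {s t : Fin m → Fin n} {a : Fin n → X.Quot} :
    a ∈ X.ext (conj fun i => RegFormula.eq (s i) (t i)) ↔ ∀ i, a (s i) = a (t i) := by
  obtain ⟨d, rfl⟩ := X.exists_mk a
  rw [mk_mem_ext]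
  induction m with
  | zero => exact ⟨fun _ i => i.elim0, fun _ => trivial⟩
  | succ m ih =>
    rw [Fin.forall_fin_succ', ← ih]
    exact and_congr Iff.rfl ⟨fun h => Quotient.sound h, fun h => Quotient.exact h⟩

theorem mem_ext_of_provable {T : RegTheory L} (hX : X.IsModel T) {n : ℕ} {φ ψ : RegFormula L n}
    (h : Provable T φ ψ) {a : Fin n → X.Quot} (ha : a ∈ X.ext φ) : a ∈ X.ext ψ := by
  obtain ⟨d, rfl, hd⟩ := ha
  exact ⟨d, rfl, sound hX h d hd⟩

end Diagram

open Diagram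

namespace IsChaseCompleteModels

variable {V : Type v} {T : RegTheory L} {M : Set (SubDiagram L V)}

theorem provable_of_ext (hM : IsChaseCompleteModels T M) {n : ℕ} {φ ψ : RegFormula L n}
    (h : ∀ X : InclPoset M, ∀ a ∈ X.diagram.str.ext φ, a ∈ X.diagram.str.ext ψ) :
    Provable T φ ψ :=
  hM.complete fun X hX d hd =>
    (X.str.mk_mem_ext ψ d).1 (h ⟨X, hX⟩ _ ((X.str.mk_mem_ext φ d).2 hd))

/-- The extension of an object of the syntactic category in a model diagram. -/
abbrev Ext (X : InclPoset M) (P : SynCat T) : Type v := X.diagram.str.ext P.formula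

/-- The function that a morphism of the syntactic category induces in a model diagram. -/
noncomputable abbrev ev (hM : IsChaseCompleteModels T M) (X : InclPoset M) {P Q : SynCat T}
    (f : P ⟶ Q) : Ext X P → Ext X Q :=
  extMap (hM.isModel _ X.mem) f

variable {P Q R : SynCat T}

variable (hM : IsChaseCompleteModels T M)

theorem exists_graph (f : P ⟶ Q) : ∃ θ : RegFormula L (P.arity + Q.arity),
    ∀ (X : InclPoset M) (a : Ext X P) (b : Ext X Q),
      hM.ev X f a = b ↔ Fin.append a.1 b.1 ∈ X.diagram.str.ext θ := by
  obtain ⟨θ, hθ⟩ := f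
  exact ⟨θ, fun X a b => extMap_eq_iff _ _ a b⟩

theorem hom_ext {f g : P ⟶ Q} (h : ∀ X a, hM.ev X f a = hM.ev X g a) : f = g := by
  have key : ∀ {θ γ : RegFormula L (P.arity + Q.arity)} (hθ : SynCat.IsFunctional P Q θ)
      (hγ : SynCat.IsFunctional P Q γ), (∀ X a, hM.ev X (Quotient.mk _ ⟨θ, hθ⟩ : P ⟶ Q) a =
        hM.ev X (Quotient.mk _ ⟨γ, hγ⟩ : P ⟶ Q) a) → Provable T θ γ := by
    intro θ γ hθ hγ h
    refine hM.provable_of_ext fun X a ha => ?_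
    have hd := and_mem_ext _ |>.1 (mem_ext_of_provable _ (hM.isModel _ X.mem) hθ.dom_cod ha)
    rw [subst_mem_ext, subst_mem_ext] at hd
    have h₁ := (extMap_eq_iff (hM.isModel _ X.mem) (Quotient.mk _ ⟨θ, hθ⟩ : P ⟶ Q) ⟨_, hd.1⟩
      ⟨_, hd.2⟩).2 (by
        change Fin.append _ _ ∈ X.diagram.str.ext θ
        rw [Fin.append_castAdd_natAdd]
        exact ha)
    have h₂ := (extMap_eq_iff (hM.isModel _ X.mem) (Quotient.mk _ ⟨γ, hγ⟩ : P ⟶ Q) ⟨_, hd.1⟩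
      ⟨_, hd.2⟩).1 ((h X _).symm.trans h₁)
    change Fin.append _ _ ∈ X.diagram.str.ext γ at h₂
    rwa [Fin.append_castAdd_natAdd] at h₂
  obtain ⟨θ, hθ⟩ := f
  obtain ⟨γ, hγ⟩ := g
  exact Quotient.sound ⟨key hθ hγ h, key hγ hθ fun X a => (h X a).symm⟩

/-- Definable families of functions are induced by morphisms of the syntactic category. -/
theorem exists_hom (F : ∀ X : InclPoset M, Ext X P → Ext X Q)
    (θ : RegFormula L (P.arity + Q.arity))
    (hθ : ∀ X a b, F X a = b ↔ Fin.append a.1 b.1 ∈ X.diagram.str.ext θ) :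
    ∃ f : P ⟶ Q, ∀ X a, hM.ev X f a = F X a := by
  let θ' := and θ (and (P.formula.subst (Fin.castAdd Q.arity))
    (Q.formula.subst (Fin.natAdd P.arity)))
  have mem : ∀ (X : InclPoset M) (a : Fin P.arity → X.diagram.str.Quot)
      (b : Fin Q.arity → X.diagram.str.Quot), Fin.append a b ∈ X.diagram.str.ext θ' ↔
        ∃ (ha : a ∈ X.diagram.str.ext P.formula) (hb : b ∈ X.diagram.str.ext Q.formula),
          F X ⟨a, ha⟩ = ⟨b, hb⟩ := by
    intro X a b
    simp only [θ', and_mem_ext, subst_mem_ext, Fin.append_left, Fin.append_right, hθ]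
    exact ⟨fun h => ⟨h.2.1, h.2.2, h.1⟩, fun ⟨h₁, h₂, h₃⟩ => ⟨h₃, h₁, h₂⟩⟩
  have hf : SynCat.IsFunctional P Q θ' := by
    refine ⟨Provable.and_right _ _, hM.provable_of_ext fun X a ha => ?_, fun j =>
      hM.provable_of_ext fun X a ha => ?_⟩
    · rw [exs_mem_ext]
      exact ⟨(F X ⟨a, ha⟩).1, (mem X _ _).2 ⟨ha, (F X ⟨a, ha⟩).2, rfl⟩⟩
    · rw [and_mem_ext, subst_mem_ext, subst_mem_ext, comp_append, comp_append, mem, mem] at ha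
      obtain ⟨⟨h₁, h₂, h₃⟩, h₄, h₅, h₆⟩ := ha
      have h₇ := congrArg Subtype.val (h₃.symm.trans h₆)
      obtain ⟨d, rfl⟩ := X.diagram.str.exists_mk a
      rw [mk_mem_ext]
      exact Quotient.exact (congrFun h₇ j)
  refine ⟨Quotient.mk _ ⟨θ', hf⟩, fun X a => (extMap_eq_iff _ _ _ _).2 ?_⟩
  exact (mem X _ _).2 ⟨a.2, (F X a).2, rfl⟩

/-- The relation `f(a) = g(b)` is definable. -/
theorem exists_eqFormula (f : P ⟶ R) (g : Q ⟶ R) : ∃ θ : RegFormula L (P.arity + Q.arity),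
    ∀ (X : InclPoset M) (a : Ext X P) (b : Ext X Q),
      Fin.append a.1 b.1 ∈ X.diagram.str.ext θ ↔ hM.ev X f a = hM.ev X g b := by
  obtain ⟨θ, hθ⟩ := hM.exists_graph f
  obtain ⟨γ, hγ⟩ := hM.exists_graph g
  refine ⟨exs R.arity (and (R.formula.subst (Fin.natAdd _)) (and
    (θ.subst (Fin.append (fun i => Fin.castAdd _ (Fin.castAdd _ i)) (Fin.natAdd _)))
    (γ.subst (Fin.append (fun i => Fin.castAdd _ (Fin.natAdd _ i)) (Fin.natAdd _))))),
    fun X a b => ?_⟩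
  simp only [exs_mem_ext, and_mem_ext, subst_mem_ext, comp_append, Fin.append_left,
    Fin.append_right]
  constructor
  · rintro ⟨c, hc, h₁, h₂⟩
    exact ((hθ X a ⟨c, hc⟩).2 h₁).trans ((hγ X b ⟨c, hc⟩).2 h₂).symm
  · intro h
    exact ⟨(hM.ev X f a).1, (hM.ev X f a).2, (hθ X a _).1 rfl, (hγ X b _).1 h.symm⟩

theorem ev_id (X : InclPoset M) (a : Ext X P) : hM.ev X (𝟙 P) a = a := extMap_id _ P a

theorem ev_comp (X : InclPoset M) (f : P ⟶ Q) (g : Q ⟶ R) (a : Ext X P) :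
    hM.ev X (f ≫ g) a = hM.ev X g (hM.ev X f a) := extMap_comp _ f g a

/-- A morphism into the domain of a morphism that is injective in all models factors through
it if it does so in all models. -/
theorem exists_factor (m : P ⟶ R) (hm : ∀ X, Function.Injective (hM.ev X m)) (g : Q ⟶ R)
    (h : ∀ X a, ∃ b, hM.ev X m b = hM.ev X g a) : ∃ k : Q ⟶ P, k ≫ m = g := by
  choose F hF using h
  obtain ⟨θ, hθ⟩ := hM.exists_eqFormula g m
  obtain ⟨k, hk⟩ := hM.exists_hom F θ fun X a b => by
    rw [hθ, ← hF]
    exact ⟨fun h => h ▸ rfl, fun h => hm X h⟩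
  exact ⟨k, hM.hom_ext fun X a => by rw [ev_comp, hk, hF]⟩

theorem isIso_of_bijective (f : P ⟶ Q) (hf : ∀ X, Function.Bijective (hM.ev X f)) : IsIso f := by
  obtain ⟨g, hg⟩ := hM.exists_factor f (fun X => (hf X).1) (𝟙 Q) fun X a => by
    simpa [ev_id] using (hf X).2 a
  refine ⟨g, hM.hom_ext fun X a => (hf X).1 ?_, hg⟩
  rw [← ev_comp, Category.assoc, hg, Category.comp_id, ev_id]

/-- Reindexing a tuple of variables is definable. -/
theorem exists_reindex (s : Fin Q.arity → Fin P.arity) (h : ∀ (X : InclPoset M) (a : Ext X P),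
    (fun i => a.1 (s i)) ∈ X.diagram.str.ext Q.formula) :
    ∃ f : P ⟶ Q, ∀ X a, (hM.ev X f a).1 = fun i => a.1 (s i) := by
  obtain ⟨f, hf⟩ := hM.exists_hom (fun X a => ⟨_, h X a⟩)
    (conj fun i => RegFormula.eq (Fin.castAdd _ (s i)) (Fin.natAdd _ i)) fun X a b => by
      rw [conj_eq_mem_ext]
      simp [Subtype.ext_iff, funext_iff]
  exact ⟨f, fun X a => by rw [hf]⟩

/-- The subobject defined by a formula. -/
theorem exists_subobject (Q : SynCat T) (γ : RegFormula L Q.arity) :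
    ∃ (P : SynCat T) (m : P ⟶ Q), (∀ X, Function.Injective (hM.ev X m)) ∧
      ∀ X b, (∃ a, hM.ev X m a = b) ↔ b.1 ∈ X.diagram.str.ext γ := by
  obtain ⟨m, hm⟩ := hM.exists_reindex (P := ⟨Q.arity, and γ Q.formula⟩) (Q := Q) (fun i => i)
    fun X a => ((and_mem_ext _).1 a.2).2
  refine ⟨_, m, fun X a b h => ?_, fun X b => ⟨?_, fun h => ?_⟩⟩
  · have := congrArg Subtype.val h
    rw [hm, hm] at this
    exact Subtype.ext this
  · rintro ⟨a, rfl⟩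
    rw [hm]
    exact ((and_mem_ext _).1 a.2).1
  · exact ⟨⟨b.1, (and_mem_ext _).2 ⟨h, b.2⟩⟩, Subtype.ext (hm X _)⟩

theorem exists_rangeFormula (f : P ⟶ Q) : ∃ γ : RegFormula L Q.arity, ∀ X (b : Ext X Q),
    b.1 ∈ X.diagram.str.ext γ ↔ ∃ a, hM.ev X f a = b := by
  obtain ⟨θ, hθ⟩ := hM.exists_eqFormula (𝟙 Q) f
  refine ⟨exs P.arity (and (P.formula.subst (Fin.natAdd _)) θ), fun X b => ?_⟩
  simp only [exs_mem_ext, and_mem_ext, subst_mem_ext, Fin.append_right]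
  constructor
  · rintro ⟨a, ha, h⟩
    exact ⟨⟨a, ha⟩, (((hθ X b ⟨a, ha⟩).1 h).symm.trans (hM.ev_id X b))⟩
  · rintro ⟨a, rfl⟩
    exact ⟨a.1, a.2, (hθ X _ a).2 (hM.ev_id X _)⟩

/-- Images in the syntactic category. -/
theorem exists_image (f : P ⟶ Q) : ∃ (I : SynCat T) (e : P ⟶ I) (m : I ⟶ Q), e ≫ m = f ∧
    (∀ X, Function.Surjective (hM.ev X e)) ∧ ∀ X, Function.Injective (hM.ev X m) := by
  obtain ⟨γ, hγ⟩ := hM.exists_rangeFormula f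
  obtain ⟨I, m, hm, hI⟩ := hM.exists_subobject Q γ
  obtain ⟨e, he⟩ := hM.exists_factor m hm f fun X a => (hI X _).2 ((hγ X _).2 ⟨a, rfl⟩)
  refine ⟨I, e, m, he, fun X b => ?_, hm⟩
  obtain ⟨a, ha⟩ := (hγ X _).1 ((hI X _).1 ⟨b, rfl⟩)
  exact ⟨a, hm X (by rw [← ev_comp, he, ha])⟩

theorem mono_of_injective (m : P ⟶ Q) (hm : ∀ X, Function.Injective (hM.ev X m)) : Mono m :=
  ⟨fun g h hgh => hM.hom_ext fun X a => hm X (by rw [← ev_comp, ← ev_comp, hgh])⟩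

theorem nonempty_hom_top (hM : IsChaseCompleteModels T M) (P : SynCat T) :
    Nonempty (P ⟶ (⟨0, top⟩ : SynCat T)) :=
  let ⟨f, _⟩ := hM.exists_reindex (P := P) (Q := ⟨0, top⟩) Fin.elim0 fun _ _ =>
    ⟨Fin.elim0, funext fun i => i.elim0, trivial⟩
  ⟨f⟩

theorem subsingleton_ext_top (X : InclPoset M) : Subsingleton (Ext X (⟨0, top⟩ : SynCat T)) :=
  ⟨fun _ _ => Subtype.ext (funext fun i => i.elim0)⟩

theorem hasTerminal (hM : IsChaseCompleteModels T M) : HasTerminal (SynCat T) :=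
  IsTerminal.hasTerminal (X := ⟨0, top⟩)
    (IsTerminal.ofUniqueHom (fun P => (hM.nonempty_hom_top P).some) fun _ _ =>
      hM.hom_ext fun X _ => (subsingleton_ext_top X).elim _ _)

theorem nonempty_unique_of_isTerminal (hM : IsChaseCompleteModels T M) (hP : IsTerminal P)
    (X : InclPoset M) : Nonempty (Unique (Ext X P)) := by
  have a : Ext X (⟨0, top⟩ : SynCat T) := ⟨Fin.elim0, Fin.elim0, funext fun i => i.elim0, trivial⟩
  obtain ⟨g⟩ := hM.nonempty_hom_top P
  refine ⟨⟨hM.ev X (hP.from _) a⟩, fun b => ?_⟩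
  have h : g ≫ hP.from ⟨0, top⟩ = 𝟙 P := hP.hom_ext _ _
  rw [← hM.ev_id X b, ← h, ev_comp]
  exact congrArg _ ((subsingleton_ext_top X).elim _ _)

variable {A B C : SynCat T}

/-- Squares that are pullbacks in all models are pullbacks. -/
theorem isPullback_of_ev {fst : P ⟶ A} {snd : P ⟶ B} {f : A ⟶ C} {g : B ⟶ C}
    (w : fst ≫ f = snd ≫ g)
    (hinj : ∀ X p q, hM.ev X fst p = hM.ev X fst q → hM.ev X snd p = hM.ev X snd q → p = q)
    (hex : ∀ X a b, hM.ev X f a = hM.ev X g b → ∃ p, hM.ev X fst p = a ∧ hM.ev X snd p = b) :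
    IsPullback fst snd f g := by
  have key : ∀ {Q : SynCat T} (h : Q ⟶ A) (k : Q ⟶ B), h ≫ f = k ≫ g →
      ∃ l : Q ⟶ P, l ≫ fst = h ∧ l ≫ snd = k := by
    intro Q h k hk
    have hF : ∀ X q, ∃ p, hM.ev X fst p = hM.ev X h q ∧ hM.ev X snd p = hM.ev X k q :=
      fun X q => hex X _ _ (by rw [← ev_comp, ← ev_comp, hk])
    choose F hF₁ hF₂ using hF
    obtain ⟨θ, hθ⟩ := hM.exists_eqFormula h fst
    obtain ⟨γ, hγ⟩ := hM.exists_eqFormula k snd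
    obtain ⟨l, hl⟩ := hM.exists_hom F (and θ γ) fun X q p => by
      rw [and_mem_ext, hθ, hγ, ← hF₁, ← hF₂]
      exact ⟨fun h => h ▸ ⟨rfl, rfl⟩, fun h => hinj X _ _ h.1 h.2⟩
    exact ⟨l, hM.hom_ext fun X q => by rw [ev_comp, hl, hF₁],
      hM.hom_ext fun X q => by rw [ev_comp, hl, hF₂]⟩
  choose l hl₁ hl₂ using fun s : PullbackCone f g => key s.fst s.snd s.condition
  refine ⟨⟨w⟩, ⟨PullbackCone.IsLimit.mk w l hl₁ hl₂ fun s k h₁ h₂ =>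
    hM.hom_ext fun X q => hinj X _ _ ?_ ?_⟩⟩
  · rw [← ev_comp, ← ev_comp, h₁, hl₁]
  · rw [← ev_comp, ← ev_comp, h₂, hl₂]

theorem exists_isPullback (f : A ⟶ C) (g : B ⟶ C) :
    ∃ (P : SynCat T) (fst : P ⟶ A) (snd : P ⟶ B), IsPullback fst snd f g ∧
      (∀ X p q, hM.ev X fst p = hM.ev X fst q → hM.ev X snd p = hM.ev X snd q → p = q) ∧
      ∀ X a b, hM.ev X f a = hM.ev X g b → ∃ p, hM.ev X fst p = a ∧ hM.ev X snd p = b := by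
  obtain ⟨θ, hθ⟩ := hM.exists_eqFormula f g
  let P : SynCat T := ⟨A.arity + B.arity, and θ (and (A.formula.subst (Fin.castAdd _))
    (B.formula.subst (Fin.natAdd _)))⟩
  have mem : ∀ (X : InclPoset M) (c : Fin (A.arity + B.arity) → X.diagram.str.Quot),
      c ∈ X.diagram.str.ext P.formula ↔
        ∃ (ha : (fun i => c (Fin.castAdd _ i)) ∈ X.diagram.str.ext A.formula)
          (hb : (fun i => c (Fin.natAdd _ i)) ∈ X.diagram.str.ext B.formula),
          hM.ev X f ⟨_, ha⟩ = hM.ev X g ⟨_, hb⟩ := by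
    intro X c
    simp only [P, and_mem_ext, subst_mem_ext, ← hθ, Fin.append_castAdd_natAdd]
    exact ⟨fun h => ⟨h.2.1, h.2.2, h.1⟩, fun ⟨h₁, h₂, h₃⟩ => ⟨h₃, h₁, h₂⟩⟩
  obtain ⟨fst, hfst⟩ := hM.exists_reindex (P := P) (Q := A) (Fin.castAdd _)
    fun X a => ((mem X _).1 a.2).1
  obtain ⟨snd, hsnd⟩ := hM.exists_reindex (P := P) (Q := B) (Fin.natAdd _)
    fun X a => ((mem X _).1 a.2).2.1
  have w : fst ≫ f = snd ≫ g := hM.hom_ext fun X p => by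
    obtain ⟨ha, hb, h⟩ := (mem X _).1 p.2
    rw [ev_comp, ev_comp]
    convert h using 2
    · exact Subtype.ext (hfst X p)
    · exact Subtype.ext (hsnd X p)
  have hinj : ∀ X p q, hM.ev X fst p = hM.ev X fst q → hM.ev X snd p = hM.ev X snd q → p = q := by
    intro X p q h₁ h₂
    have h₁ := congrArg Subtype.val h₁
    have h₂ := congrArg Subtype.val h₂
    rw [hfst, hfst] at h₁
    rw [hsnd, hsnd] at h₂
    exact Subtype.ext (funext fun i => Fin.addCases (congrFun h₁) (congrFun h₂) i)
  have hex : ∀ X a b, hM.ev X f a = hM.ev X g b →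
      ∃ p, hM.ev X fst p = a ∧ hM.ev X snd p = b := by
    intro X a b hab
    have hp : Fin.append a.1 b.1 ∈ X.diagram.str.ext P.formula := by
      refine (mem X _).2 ?_
      simp only [Fin.append_left, Fin.append_right]
      exact ⟨a.2, b.2, hab⟩
    refine ⟨⟨_, hp⟩, Subtype.ext ?_, Subtype.ext ?_⟩
    · rw [hfst]; funext i; exact Fin.append_left _ _ i
    · rw [hsnd]; funext i; exact Fin.append_right _ _ i
  exact ⟨P, fst, snd, hM.isPullback_of_ev w hinj hex, hinj, hex⟩

theorem hasPullbacks (hM : IsChaseCompleteModels T M) : HasPullbacks (SynCat T) := by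
  refine @hasPullbacks_of_hasLimit_cospan _ _ fun {A B C f g} => ?_
  obtain ⟨P, fst, snd, h, -⟩ := hM.exists_isPullback f g
  exact h.hasPullback

section IsPullback

variable {fst : P ⟶ A} {snd : P ⟶ B} {f : A ⟶ C} {g : B ⟶ C}

theorem ev_ext_of_isPullback (h : IsPullback fst snd f g) (X : InclPoset M)
    {p q : Ext X P} (h₁ : hM.ev X fst p = hM.ev X fst q)
    (h₂ : hM.ev X snd p = hM.ev X snd q) : p = q := by
  obtain ⟨P', fst', snd', h', hinj, -⟩ := hM.exists_isPullback f g
  have key : (h'.lift fst snd h.w) ≫ (h.lift fst' snd' h'.w) = 𝟙 P := by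
    refine h.hom_ext ?_ ?_ <;> simp
  rw [← hM.ev_id X p, ← hM.ev_id X q, ← key, ev_comp, ev_comp]
  refine congrArg _ (hinj X _ _ ?_ ?_)
  · simpa only [← ev_comp, IsPullback.lift_fst] using h₁
  · simpa only [← ev_comp, IsPullback.lift_snd] using h₂

theorem exists_ev_of_isPullback (h : IsPullback fst snd f g)
    (X : InclPoset M) (a : Ext X A) (b : Ext X B) (hab : hM.ev X f a = hM.ev X g b) :
    ∃ p, hM.ev X fst p = a ∧ hM.ev X snd p = b := by
  obtain ⟨P', fst', snd', h', -, hex⟩ := hM.exists_isPullback f g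
  obtain ⟨p, hp₁, hp₂⟩ := hex X a b hab
  refine ⟨hM.ev X (h.lift fst' snd' h'.w) p, ?_, ?_⟩
  · rw [← ev_comp, h.lift_fst, hp₁]
  · rw [← ev_comp, h.lift_snd, hp₂]

end IsPullback

theorem injective_of_mono (m : P ⟶ Q) [Mono m] (X : InclPoset M) :
    Function.Injective (hM.ev X m) := by
  intro a b hab
  obtain ⟨_, fst, snd, h, -, hex⟩ := hM.exists_isPullback m m
  obtain ⟨p, rfl, rfl⟩ := hex X a b hab
  rw [(cancel_mono m).1 h.w]

/-- A morphism that is surjective in all models is the coequalizer of any pair of morphisms that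
covers its kernel in all models. -/
theorem nonempty_isColimit_cofork {e : P ⟶ Q} (he : ∀ X, Function.Surjective (hM.ev X e))
    {g₁ g₂ : R ⟶ P} (w : g₁ ≫ e = g₂ ≫ e)
    (hk : ∀ X a b, hM.ev X e a = hM.ev X e b → ∃ c, hM.ev X g₁ c = a ∧ hM.ev X g₂ c = b) :
    Nonempty (IsColimit (Cofork.ofπ e w)) := by
  have key : ∀ {W : SynCat T} (h : P ⟶ W), g₁ ≫ h = g₂ ≫ h → ∃ k : Q ⟶ W, e ≫ k = h := by
    intro W h hh
    have hwd : ∀ X a b, hM.ev X e a = hM.ev X e b → hM.ev X h a = hM.ev X h b := by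
      intro X a b hab
      obtain ⟨c, rfl, rfl⟩ := hk X a b hab
      rw [← ev_comp, ← ev_comp, hh]
    choose s hs using he
    obtain ⟨θ, hθ⟩ := hM.exists_eqFormula (𝟙 Q) e
    obtain ⟨γ, hγ⟩ := hM.exists_eqFormula h (𝟙 W)
    obtain ⟨k, hk⟩ := hM.exists_hom (fun X q => hM.ev X h (s X q))
      (exs P.arity (and (P.formula.subst (Fin.natAdd _)) (and
        (θ.subst (Fin.append (fun i => Fin.castAdd _ (Fin.castAdd _ i)) (Fin.natAdd _)))
        (γ.subst (Fin.append (Fin.natAdd _) (fun i => Fin.castAdd _ (Fin.natAdd _ i)))))))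
      fun X q c => by
      simp only [exs_mem_ext, and_mem_ext, subst_mem_ext, comp_append, Fin.append_left,
        Fin.append_right]
      constructor
      · rintro rfl
        exact ⟨(s X q).1, (s X q).2, (hθ X q _).2 (by rw [ev_id, hs]), (hγ X _ _).2 (by rw [ev_id])⟩
      · rintro ⟨a, ha, h₁, h₂⟩
        have h₁ := (hθ X q ⟨a, ha⟩).1 h₁
        have h₂ := (hγ X ⟨a, ha⟩ c).1 h₂
        rw [ev_id] at h₁ h₂
        rw [← h₂]
        exact hwd X _ _ ((hs X q).trans h₁)
    exact ⟨k, hM.hom_ext fun X a => by rw [ev_comp, hk]; exact hwd X _ _ (hs X _)⟩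
  choose k hk' using fun s : Cofork g₁ g₂ => key s.π s.condition
  refine ⟨Cofork.IsColimit.mk _ k hk' fun s l hl => hM.hom_ext fun X q => ?_⟩
  obtain ⟨a, rfl⟩ := he X q
  rw [← ev_comp, ← ev_comp, hk', ← hl]
  rfl

theorem isRegularEpi_iff (f : P ⟶ Q) :
    IsRegularEpi f ↔ ∀ X, Function.Surjective (hM.ev X f) := by
  constructor
  · intro hf
    obtain ⟨I, e, m, rfl, he, hm⟩ := hM.exists_image f
    have := hM.mono_of_injective m hm
    have := strongEpi_of_strongEpi e m
    have := isIso_of_mono_of_strongEpi m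
    intro X b
    obtain ⟨a, ha⟩ := he X (hM.ev X (inv m) b)
    exact ⟨a, by rw [ev_comp, ha, ← ev_comp, IsIso.inv_hom_id, ev_id]⟩
  · intro hf
    obtain ⟨K, fst, snd, h, -, hex⟩ := hM.exists_isPullback f f
    exact ⟨⟨⟨K, fst, snd, h.w, (hM.nonempty_isColimit_cofork hf h.w hex).some⟩⟩⟩

theorem regular (hM : IsChaseCompleteModels T M) : Regular (SynCat T) := by
  have := hM.hasTerminal
  have := hM.hasPullbacks
  have := hasFiniteLimits_of_hasTerminal_and_pullbacks (C := SynCat T)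
  refine { hasCoequalizer_of_isKernelPair := ?_, regularEpiIsStableUnderBaseChange := ⟨?_⟩ }
  · intro P Q K f g₁ g₂ h
    obtain ⟨I, e, m, rfl, he, hm⟩ := hM.exists_image f
    have := hM.mono_of_injective m hm
    have w : g₁ ≫ e = g₂ ≫ e := by
      rw [← cancel_mono m, Category.assoc, Category.assoc, h.w]
    obtain ⟨hc⟩ := hM.nonempty_isColimit_cofork he w fun X a b hab =>
      hM.exists_ev_of_isPullback h X a b (by rw [ev_comp, ev_comp, hab])
    exact ⟨⟨⟨_, hc⟩⟩⟩
  · intro A B P C f g f' g' h hg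
    rw [MorphismProperty.regularEpi_iff, hM.isRegularEpi_iff] at hg ⊢
    intro X a
    obtain ⟨b, hb⟩ := hg X (hM.ev X f a)
    obtain ⟨p, -, hp⟩ := hM.exists_ev_of_isPullback h X b a hb
    exact ⟨p, hp⟩

end IsChaseCompleteModels

section Subfunctor

variable {C : Type x} [Category.{x'} C] {F G : C ⥤ Type w}

theorem range_subobject_mk (m : F ⟶ G) [Mono m] :
    Subfunctor.range (Subobject.mk m).arrow = Subfunctor.range m := by
  refine le_antisymm ?_ ?_
  · rw [← Subobject.underlyingIso_hom_comp_eq_mk]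
    exact Subfunctor.range_comp_le _ _
  · conv_lhs => rw [← Subobject.underlyingIso_arrow m]
    exact Subfunctor.range_comp_le _ _

theorem range_subobject_pullback (p : F ⟶ G) (U : Subobject G) :
    Subfunctor.range ((Subobject.pullback p).obj U).arrow =
      (Subfunctor.range U.arrow).preimage p := by
  have h := Subobject.isPullback p U
  ext X a
  constructor
  · rintro ⟨c, rfl⟩
    exact ⟨(Subobject.pullbackπ p U).app X c, ConcreteCategory.congr_hom (h.app X).w c⟩
  · rintro ⟨c, hc⟩
    obtain ⟨d, -, hd⟩ := Types.exists_of_isPullback (h.app X) c a hc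
    exact ⟨d, hd⟩

/-- The universal quantification of a subfunctor along a natural transformation. -/
def subfunctorForall (p : F ⟶ G) (S : Subfunctor F) : Subfunctor G where
  obj X := {b | ∀ (Y : C) (i : X ⟶ Y) (a : F.obj Y), p.app Y a = G.map i b → a ∈ S.obj Y}
  map {X Y} i b hb Z j a ha := hb Z (i ≫ j) a (by rw [ha]; simp)

theorem preimage_le_iff_le_forall (p : F ⟶ G) (S : Subfunctor F) (U : Subfunctor G) :
    U.preimage p ≤ S ↔ U ≤ subfunctorForall p S := by
  constructor
  · intro h X b hb Y i a ha
    refine h Y ?_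
    change p.app Y a ∈ U.obj Y
    rw [ha]
    exact U.map i hb
  · intro h X a ha
    exact h X ha X (𝟙 X) a (by simp)

theorem orderIsoSubobject_symm_eq (U : Subobject F) :
    (Subfunctor.orderIsoSubobject F).symm U = Subfunctor.range U.arrow := rfl

/-- Universal quantification of subobjects of type-valued functors. -/
noncomputable def subobjectForall (p : F ⟶ G) (S : Subobject F) : Subobject G :=
  Subfunctor.orderIsoSubobject G (subfunctorForall p (Subfunctor.range S.arrow))

theorem gc_subobjectForall (p : F ⟶ G) :
    GaloisConnection (Subobject.pullback p).obj (subobjectForall p) := by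
  intro U S
  rw [subobjectForall, ← OrderIso.symm_apply_le,
    ← (Subfunctor.orderIsoSubobject F).symm.le_iff_le]
  simp only [orderIsoSubobject_symm_eq]
  rw [range_subobject_pullback, preimage_le_iff_le_forall]

end Subfunctor

namespace IsChaseCompleteModels

variable {V : Type v} {T : RegTheory L} {M : Set (SubDiagram L V)}
  (hM : IsChaseCompleteModels T M)

/-- The evaluation functor of a chase-complete set of model diagrams. -/
noncomputable abbrev evalFunctor : SynCat T ⥤ (InclPoset M ⥤ Type v) :=
  evaluationFunctor T M hM.isModel

variable {P Q A B : SynCat T}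

theorem reflectsIsomorphisms : hM.evalFunctor.ReflectsIsomorphisms where
  reflects f _ := hM.isIso_of_bijective f fun X =>
    (isIso_iff_bijective ((hM.evalFunctor.map f).app X)).1 inferInstance

theorem ev_map (f : P ⟶ Q) {X Y : InclPoset M} (i : X ⟶ Y) (a : Ext X P) :
    hM.ev Y f ((hM.evalFunctor.obj P).map i a) = (hM.evalFunctor.obj Q).map i (hM.ev X f a) :=
  SubDiagram.extMap_quotMap (hM.isModel _ X.mem) (hM.isModel _ Y.mem) (leOfHom i) f a

theorem map_isPullback {C : SynCat T} {fst : P ⟶ A} {snd : P ⟶ B} {f : A ⟶ C} {g : B ⟶ C}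
    (h : IsPullback fst snd f g) :
    IsPullback (hM.evalFunctor.map fst) (hM.evalFunctor.map snd) (hM.evalFunctor.map f)
      (hM.evalFunctor.map g) :=
  .of_forall_isPullback_app fun X => (Types.isPullback_iff _ _ _ _).2
    ⟨by rw [← NatTrans.comp_app, ← NatTrans.comp_app, ← Functor.map_comp, ← Functor.map_comp, h.w],
      fun _ _ hpq => hM.ev_ext_of_isPullback h X hpq.1 hpq.2,
      fun a b hab => hM.exists_ev_of_isPullback h X a b hab⟩

theorem preservesFiniteLimits : PreservesFiniteLimits hM.evalFunctor := by
  have := hM.hasTerminal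
  have := hM.hasPullbacks
  have : PreservesLimitsOfShape WalkingCospan hM.evalFunctor :=
    preservesLimitsOfShape_walkingCospan_of_forall_isPullback fun A B C f g _ => by
      obtain ⟨P, fst, snd, h, -⟩ := hM.exists_isPullback f g
      exact ⟨P, fst, snd, h, hM.map_isPullback h⟩
  have : PreservesLimit (Functor.empty.{0} (SynCat T)) hM.evalFunctor := by
    have hu := fun X =>
      (hM.nonempty_unique_of_isTerminal (terminalIsTerminal (C := SynCat T)) X).some
    have ht : IsTerminal (hM.evalFunctor.obj (⊤_ SynCat T)) := by
      refine IsTerminal.ofUniqueHom (fun F =>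
        { app := fun X => TypeCat.ofHom fun _ => (hu X).default
          naturality := fun X Y i => ?_ }) fun F g => ?_
      · ext a
        exact @Subsingleton.elim _ (hu Y).instSubsingleton _ _
      · ext X a
        exact @Subsingleton.elim _ (hu X).instSubsingleton _ _
    have := isIso_of_isTerminal ht terminalIsTerminal (terminal.from _)
    exact preservesTerminal_of_isIso hM.evalFunctor (terminal.from _)
  have := preservesLimitsOfShape_pempty_of_preservesTerminal hM.evalFunctor
  exact preservesFiniteLimits_of_preservesTerminal_and_pullbacks _

theorem map_isRegularEpi (f : P ⟶ Q) (hf : IsRegularEpi f) :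
    IsRegularEpi (hM.evalFunctor.map f) := by
  have : Epi (hM.evalFunctor.map f) := by
    rw [NatTrans.epi_iff_epi_app]
    exact fun X => (epi_iff_surjective _).2 ((hM.isRegularEpi_iff f).1 hf X)
  exact IsRegularEpiCategory.regularEpiOfEpi _

theorem subobject_le {U S : Subobject B}
    (h : ∀ X a, ∃ b, hM.ev X S.arrow b = hM.ev X U.arrow a) : U ≤ S := by
  obtain ⟨k, hk⟩ := hM.exists_factor S.arrow (hM.injective_of_mono _) U.arrow h
  exact Subobject.le_of_comm k hk

theorem exists_ev_of_le {U S : Subobject B} (h : U ≤ S) (X : InclPoset M)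
    (a : Ext X (U : SynCat T)) : ∃ b, hM.ev X S.arrow b = hM.ev X U.arrow a :=
  ⟨hM.ev X (U.ofLE S h) a, by rw [← ev_comp, Subobject.ofLE_arrow]⟩

/-- The tuple of elements of an extension `Y` of a model diagram `X` given by an element of the
extension of a formula in `X`. -/
theorem map_mk_val {X Y : InclPoset M} (i : X ⟶ Y) (b : (hM.evalFunctor.obj B).obj X)
    (d : Fin B.arity → X.diagram.dom)
    (hd : (fun i => (Quotient.mk X.diagram.str.setoid (d i) : X.diagram.str.Quot)) = b.1) :
    ((hM.evalFunctor.obj B).map i b).1 = fun j => (Quotient.mk Y.diagram.str.setoid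
      (Set.inclusion (leOfHom i).1 (d j)) : Y.diagram.str.Quot) := by
  funext j
  change SubDiagram.quotMap (leOfHom i) (b.1 j) = _
  rw [← hd]
  rfl

/-- The universal quantification of the evaluation of a subobject is contained in the evaluation
of its universal quantification. -/
theorem exists_ev_of_mem_forall [HasPullbacks (SynCat T)] (f : A ⟶ B)
    {R : Subobject A ⥤ Subobject B} (hR : Subobject.pullback f ⊣ R) (S : Subobject A)
    (X : InclPoset M) (b : Ext X B)
    (hb : ∀ (Y : InclPoset M) (i : X ⟶ Y) (a : Ext Y A),
      hM.ev Y f a = (hM.evalFunctor.obj B).map i b → ∃ s, hM.ev Y S.arrow s = a) :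
    ∃ c, hM.ev X (R.obj S).arrow c = b := by
  obtain ⟨d, hd⟩ := X.diagram.str.exists_mk b.1
  obtain ⟨θ, hθ⟩ := hM.exists_eqFormula (𝟙 B) f
  obtain ⟨σ, hσ⟩ := hM.exists_rangeFormula S.arrow
  obtain ⟨δ, hδ, H⟩ := hM.exists_formula X.mem d (and θ (A.formula.subst (Fin.natAdd _)))
    (σ.subst (Fin.natAdd _)) (by
      intro Y hY hXY c hc
      let i : X ⟶ ⟨Y, hY⟩ := homOfLE hXY
      have hbi := hM.map_mk_val i b d hd
      have hcA : Y.str.Sat A.formula c := by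
        have := hc.2
        rw [sat_subst] at this
        simpa using this
      have hcθ := (append_mk_mem_ext _ _ _ _).2 hc.1
      let a : Ext (⟨Y, hY⟩ : InclPoset M) A := ⟨_, (mk_mem_ext _ _ _).2 hcA⟩
      obtain ⟨s, hs⟩ := hb ⟨Y, hY⟩ i a <| by
        rw [← hM.ev_id ⟨Y, hY⟩ ((hM.evalFunctor.obj B).map i b)]
        refine ((hθ ⟨Y, hY⟩ _ a).1 ?_).symm
        rw [hbi]
        exact hcθ
      have := (hσ ⟨Y, hY⟩ a).2 ⟨s, hs⟩
      rw [sat_subst]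
      simpa using (mk_mem_ext _ _ _).1 this)
  obtain ⟨I, m, hm, hI⟩ := hM.exists_subobject B δ
  have := hM.mono_of_injective m hm
  have hle : (Subobject.pullback f).obj (Subobject.mk m) ≤ S := by
    refine hM.subobject_le fun Y p => (hσ Y _).1 ?_
    have hw := (Subobject.isPullback f (Subobject.mk m)).w
    set a := hM.ev Y ((Subobject.pullback f).obj (Subobject.mk m)).arrow p with ha
    have hfa : ∃ c, hM.ev Y m c = hM.ev Y f a := by
      refine ⟨hM.ev Y (Subobject.underlyingIso m).hom
        (hM.ev Y (Subobject.pullbackπ f (Subobject.mk m)) p), ?_⟩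
      rw [ha, ← ev_comp, ← ev_comp, ← ev_comp, ← hw,
        ← Subobject.underlyingIso_hom_comp_eq_mk]
    have h₁ := mem_ext_of_provable _ (hM.isModel _ Y.mem) H
      (a := Fin.append (hM.ev Y f a).1 a.1) <| by
        simp only [and_mem_ext, subst_mem_ext, Fin.append_left, Fin.append_right, hθ]
        exact ⟨(hI Y _).1 hfa, hM.ev_id _ _, a.2⟩
    rw [subst_mem_ext] at h₁
    simpa using h₁
  obtain ⟨c, hc⟩ := (hI X b).2 (by rw [← hd]; exact (mk_mem_ext _ _ _).2 hδ)
  obtain ⟨e, he⟩ := hM.exists_ev_of_le ((hR.gc _ _).1 hle) X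
    (hM.ev X (Subobject.underlyingIso m).inv c)
  exact ⟨e, by rw [he, ← ev_comp, Subobject.underlyingIso_arrow, hc]⟩

theorem mem_range_mapSubobject [hM.evalFunctor.PreservesMonomorphisms] (S : Subobject A)
    (X : InclPoset M) (a : Ext X A) :
    a ∈ (Subfunctor.range (mapSubobject hM.evalFunctor S).arrow).obj X ↔
      ∃ s, hM.ev X S.arrow s = a := by
  rw [mapSubobject, range_subobject_mk]
  rfl

theorem mem_forall [hM.evalFunctor.PreservesMonomorphisms] (f : A ⟶ B) (S : Subobject A)
    (X : InclPoset M) (b : Ext X B) :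
    b ∈ (subfunctorForall (hM.evalFunctor.map f)
        (Subfunctor.range (mapSubobject hM.evalFunctor S).arrow)).obj X ↔
      ∀ (Y : InclPoset M) (i : X ⟶ Y) (a : Ext Y A),
        hM.ev Y f a = (hM.evalFunctor.obj B).map i b → ∃ s, hM.ev Y S.arrow s = a :=
  forall₂_congr fun Y _ => forall₂_congr fun a _ => hM.mem_range_mapSubobject S Y a

theorem mem_forall_of_ev [HasPullbacks (SynCat T)] (f : A ⟶ B) {R : Subobject A ⥤ Subobject B}
    (hR : Subobject.pullback f ⊣ R) (S : Subobject A) (X : InclPoset M)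
    (c : Ext X (R.obj S : SynCat T)) (Y : InclPoset M) (i : X ⟶ Y) (a : Ext Y A)
    (ha : hM.ev Y f a = (hM.evalFunctor.obj B).map i (hM.ev X (R.obj S).arrow c)) :
    ∃ s, hM.ev Y S.arrow s = a := by
  rw [← ev_map] at ha
  obtain ⟨p, -, rfl⟩ := hM.exists_ev_of_isPullback (Subobject.isPullback f (R.obj S)) Y _ a ha.symm
  exact hM.exists_ev_of_le ((hR.gc _ _).2 le_rfl) Y p

theorem map_forall [HasPullbacks (SynCat T)] [hM.evalFunctor.PreservesMonomorphisms] (f : A ⟶ B)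
    {R : Subobject A ⥤ Subobject B} (hR : Subobject.pullback f ⊣ R) (S : Subobject A) :
    subobjectForall (hM.evalFunctor.map f) (mapSubobject hM.evalFunctor S) =
      mapSubobject hM.evalFunctor (R.obj S) := by
  refine (Subfunctor.orderIsoSubobject _).symm.injective ?_
  rw [subobjectForall, OrderIso.symm_apply_apply, orderIsoSubobject_symm_eq]
  refine le_antisymm (fun X b hb => ?_) (fun X b hb => ?_)
  · exact (hM.mem_range_mapSubobject _ X b).2
      (hM.exists_ev_of_mem_forall f hR S X b ((hM.mem_forall f S X b).1 hb))
  · obtain ⟨c, hc⟩ := (hM.mem_range_mapSubobject _ X b).1 hb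
    refine (hM.mem_forall f S X b).2 fun Y i a ha => hM.mem_forall_of_ev f hR S X c Y i a ?_
    rw [hc]
    exact ha

end IsChaseCompleteModels

end RegLogic

open RegLogic
theorem mainTheorem6 {L : FirstOrder.Language.{u, u'}} [L.IsRelational] (T : RegTheory L)
    {V : Type v} (M : Set (SubDiagram L V)) (hM : IsChaseCompleteModels T M) :
    ∃ _ : Regular (SynCat T),
      (evaluationFunctor T M hM.isModel).ReflectsIsomorphisms ∧
      IsConditionallySubHeyting (evaluationFunctor T M hM.isModel) := by
  have := hM.preservesFiniteLimits
  have hreg := hM.regular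
  refine ⟨hreg, hM.reflectsIsomorphisms, ⟨this, hM.map_isRegularEpi⟩, fun f R hR => ?_⟩
  exact ⟨_, ⟨(gc_subobjectForall _).adjunction⟩, fun S => hM.map_forall f hR S⟩
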